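/- Let $\nu$ be a Borel probability measure on $\mathrm{SL}(2,\mathbb{R})$ with $$\int \log \|M\| \, d\nu(M) < \infty ,$$ where $\|\cdot\|$ is the operator norm associated with the Euclidean norm on $\mathbb{R}^2$. Let $G_\nu$ be the smallest closed subgroup of $\mathrm{SL}(2,\mathbb{R})$ which contains $\mathrm{supp}\,\nu$, and let $\mathbb{P}^1$ be the set of lines through the origin in $\mathbb{R}^2$, on which $\mathrm{SL}(2,\mathbb{R})$ acts in the natural way. Assume that (i) $G_\nu$ is not compact, and that one of the following two conditions holds: (ii) there is no finite non-empty set $L \subseteq \mathbb{P}^1$ such that $M(L) = L$ for all $M \in G_\nu$; (ii') there is no set $L \subseteq \mathbb{P}^1$ of cardinality $1$ or $2$ such that $M(L) = L$ for all $M \in G_\nu$. Then the Lyapunov exponent of $\nu$ exists and is strictly positive: there is a constant $\gamma > 0$ such that $$\lim_{n \to \infty} \frac1n \log \| T_n \cdots T_1 \| = \gamma$$ for $\nu^{\mathbb{Z}_+}$-almost every sequence $(T_1, T_2, \ldots)$ in $\mathrm{SL}(2,\mathbb{R})$. -/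

import Mathlib

open MeasureTheory Filter Topology
open scoped MatrixGroups LinearAlgebra.Projectivization

namespace RandomMatrixProduct

/-- `SL(2, ℝ)` carries its Borel `σ`-algebra. -/
instance instMeasurableSpaceSL : MeasurableSpace SL(2, ℝ) := borel _

instance instBorelSpaceSL : BorelSpace SL(2, ℝ) := ⟨rfl⟩

section Norm

open scoped Matrix.Norms.L2Operator

/-- The operator norm of `M ∈ SL(2, ℝ)` on `ℝ²` with its Euclidean norm. -/
noncomputable def opNorm (M : SL(2, ℝ)) : ℝ := ‖(M : Matrix (Fin 2) (Fin 2) ℝ)‖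

end Norm

/-- The projective line `ℙ¹` of directions in `ℝ²`. Mathlib's action of `SL(2, ℝ)` on it sends the
class of `v` to the class of `M v`. -/
abbrev Directions : Type := ℙ ℝ (Fin 2 → ℝ)

/-- `∫ log ‖M‖ dν(M) < ∞`. Since `‖M‖ ≥ 1` on `SL(2, ℝ)`, the integrand is nonnegative, and it is
continuous, so this is the same as integrability. -/
def LogIntegrable (ν : Measure SL(2, ℝ)) : Prop :=
  Integrable (fun M : SL(2, ℝ) => Real.log (opNorm M)) ν

/-- The closed subgroup `G_ν` generated by the support of `ν`. -/
def generatedGroup (ν : Measure SL(2, ℝ)) : Subgroup SL(2, ℝ) :=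
  (Subgroup.closure ν.support).topologicalClosure

/-- `G_ν` is the smallest closed subgroup that contains the support of `ν`. -/
theorem isLeast_generatedGroup (ν : Measure SL(2, ℝ)) :
    IsLeast {H : Subgroup SL(2, ℝ) | IsClosed (H : Set SL(2, ℝ)) ∧ ν.support ⊆ H}
      (generatedGroup ν) :=
  ⟨⟨Subgroup.isClosed_topologicalClosure _,
      Subgroup.subset_closure.trans (Subgroup.le_topologicalClosure _)⟩,
    fun _ hH => Subgroup.topologicalClosure_minimal _ ((Subgroup.closure_le _).2 hH.2) hH.1⟩

/-- `M(L) = L` for all `M ∈ G`. -/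
def IsInvariantSet (G : Subgroup SL(2, ℝ)) (L : Set Directions) : Prop :=
  ∀ M ∈ G, (fun v : Directions => M • v) '' L = L

/-- The product `M_n = T_n ⋯ T_1`, where the sequence `T_1, T_2, …` is written `T 0, T 1, …`. -/
def matrixProduct (T : ℕ → SL(2, ℝ)) : ℕ → SL(2, ℝ)
  | 0 => 1
  | n + 1 => T n * matrixProduct T n

/-- `γ` is the Lyapunov exponent of `ν`: `(1 / n) log ‖T_n ⋯ T_1‖ → γ` for almost every sequence
`(T_1, T_2, …)` with respect to the infinite product of copies of `ν`. -/
def IsLyapunovExponent (ν : Measure SL(2, ℝ)) (γ : ℝ) : Prop :=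
  ∀ᵐ T ∂(Measure.infinitePi (fun _ : ℕ => ν)),
    Tendsto (fun n : ℕ => (1 / (n : ℝ)) * Real.log (opNorm (matrixProduct T n))) atTop (𝓝 γ)

end RandomMatrixProduct

/-! Let `M` act on the unit circle by radial projection. The Jacobian of this action with respect to
arc length is `‖M x‖⁻²`, so `f ↦ f (M ·) ‖M ·‖⁻¹` is an isometry of `L²`; `transfer` is the
`ν`-average of these isometries. Its `n`-th iterate at `1` is the mean of `‖T_n ⋯ T_1 x‖⁻¹`, which
dominates the mean of `‖T_n ⋯ T_1‖⁻¹`. There are two cases.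

Suppose `⟨f, transfer f⟩ ≤ q ‖f‖²` for some `q < 1` and all `f ≥ 0`. Then the integrals of the
iterates decay exponentially (`exists_transfer_iterate_decay`), and Jensen's inequality turns this
into linear growth of the mean of `log ‖T_n ⋯ T_1‖` (`subadditive_lim_pos`).

Otherwise there are normalised `f_k ≥ 0` with `⟨f_k, transfer f_k⟩ → 1`. They are almost invariant
under `ν`-almost every `M`, and a weak limit of the probability measures `f_k² d(arc)` is invariant
under almost every `M` (`exists_invariant_measure`). The stabilizer of this limit is a closed
subgroup, hence contains `G_ν`. Since `G_ν` is not compact, it contains matrices of arbitrarily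
large norm; a limit of their normalisations has rank one, which confines the measure to at most two
lines (`exists_ae_line_eq`). The lines of positive mass form an invariant set of one or two
elements, contrary to (ii) and to (ii').

The exponent exists by the Furstenberg–Kesten theorem. The upper bound comes from the strong law for
disjoint blocks. The lower bound is a covering argument in the style of Katznelson and Weiss: a long
product is cut into blocks of bounded length that nearly realise the lower growth rate
(`logNorm_le_of_blocks`). -/

namespace RandomMatrixProduct

open ProbabilityTheory
open scoped ENNReal NNReal BoundedContinuousFunction

/-! ### The action of `SL(2, ℝ)` on the plane and on the unit circle. -/

/-- The Euclidean plane. -/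
abbrev Plane : Type := EuclideanSpace ℝ (Fin 2)

/-- The unit circle of the Euclidean plane. -/
abbrev UnitCircle : Type := Metric.sphere (0 : Plane) 1

/-- The linear map `v ↦ M v` of the Euclidean plane. -/
noncomputable def toCLM (M : SL(2, ℝ)) : Plane →L[ℝ] Plane :=
  Matrix.toEuclideanCLM (n := Fin 2) (𝕜 := ℝ) (M : Matrix (Fin 2) (Fin 2) ℝ)

theorem opNorm_eq (M : SL(2, ℝ)) : opNorm M = ‖toCLM M‖ := rfl

theorem toCLM_one : toCLM 1 = 1 := by simp [toCLM]

theorem toCLM_mul (M N : SL(2, ℝ)) : toCLM (M * N) = toCLM M * toCLM N := by simp [toCLM]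

theorem toCLM_mul_apply (M N : SL(2, ℝ)) (v : Plane) :
    toCLM (M * N) v = toCLM M (toCLM N v) := by rw [toCLM_mul]; rfl

theorem toCLM_inv_apply_apply (M : SL(2, ℝ)) (v : Plane) : toCLM M⁻¹ (toCLM M v) = v := by
  rw [← toCLM_mul_apply, inv_mul_cancel, toCLM_one]; rfl

theorem toCLM_ne_zero (M : SL(2, ℝ)) {v : Plane} (hv : v ≠ 0) : toCLM M v ≠ 0 := by
  intro h
  apply hv
  rw [← toCLM_inv_apply_apply M v, h, map_zero]

theorem ofLp_toCLM (M : SL(2, ℝ)) (v : Plane) :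
    (toCLM M v).ofLp = (M : Matrix (Fin 2) (Fin 2) ℝ).mulVec v.ofLp :=
  Matrix.ofLp_toEuclideanCLM _ _

theorem continuous_toCLM : Continuous toCLM := by
  have h : Continuous fun A : Matrix (Fin 2) (Fin 2) ℝ =>
      (Matrix.toEuclideanCLM (n := Fin 2) (𝕜 := ℝ) A : Plane →L[ℝ] Plane) :=
    LinearMap.continuous_of_finiteDimensional
      (Matrix.toEuclideanCLM (n := Fin 2) (𝕜 := ℝ)).toAlgEquiv.toLinearMap
  exact h.comp continuous_subtype_val

theorem continuous_opNorm : Continuous opNorm := continuous_toCLM.norm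

theorem opNorm_mul_le (M N : SL(2, ℝ)) : opNorm (M * N) ≤ opNorm M * opNorm N := by
  simp only [opNorm_eq, toCLM_mul]
  exact norm_mul_le _ _

/-- Each column has length at most `‖M‖`, and the sum of the squares of the entries is at least `2
det M = 2`. -/
theorem one_le_opNorm (M : SL(2, ℝ)) : 1 ≤ opNorm M := by
  have hdet : (M : Matrix (Fin 2) (Fin 2) ℝ) 0 0 * (M : Matrix (Fin 2) (Fin 2) ℝ) 1 1 -
      (M : Matrix (Fin 2) (Fin 2) ℝ) 0 1 * (M : Matrix (Fin 2) (Fin 2) ℝ) 1 0 = 1 := by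
    rw [← Matrix.det_fin_two]; exact M.2
  have hN : 0 ≤ opNorm M := norm_nonneg (toCLM M)
  have hcol (j : Fin 2) : (M : Matrix (Fin 2) (Fin 2) ℝ) 0 j ^ 2 +
      (M : Matrix (Fin 2) (Fin 2) ℝ) 1 j ^ 2 ≤ opNorm M ^ 2 := by
    have h := (toCLM M).le_opNorm (EuclideanSpace.single j 1)
    rw [PiLp.norm_single, norm_one, mul_one, ← opNorm_eq] at h
    have h2 := pow_le_pow_left₀ (norm_nonneg _) h 2
    rw [EuclideanSpace.norm_sq_eq] at h2
    simpa [Fin.sum_univ_two, ofLp_toCLM, Matrix.mulVec_single] using h2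
  have h0 := hcol 0
  have h1 := hcol 1
  nlinarith [sq_nonneg ((M : Matrix (Fin 2) (Fin 2) ℝ) 0 0 - (M : Matrix (Fin 2) (Fin 2) ℝ) 1 1),
    sq_nonneg ((M : Matrix (Fin 2) (Fin 2) ℝ) 0 1 + (M : Matrix (Fin 2) (Fin 2) ℝ) 1 0)]

theorem opNorm_pos (M : SL(2, ℝ)) : 0 < opNorm M := one_pos.trans_le (one_le_opNorm M)

theorem log_opNorm_nonneg (M : SL(2, ℝ)) : 0 ≤ Real.log (opNorm M) :=
  Real.log_nonneg (one_le_opNorm M)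

theorem log_opNorm_mul_le (M N : SL(2, ℝ)) :
    Real.log (opNorm (M * N)) ≤ Real.log (opNorm M) + Real.log (opNorm N) := by
  rw [← Real.log_mul (opNorm_pos M).ne' (opNorm_pos N).ne']
  exact Real.log_le_log (opNorm_pos _) (opNorm_mul_le M N)

theorem UnitCircle.norm_coe (x : UnitCircle) : ‖(x : Plane)‖ = 1 := by simp

theorem UnitCircle.coe_ne_zero (x : UnitCircle) : (x : Plane) ≠ 0 := by
  rw [← norm_ne_zero_iff, x.norm_coe]; exact one_ne_zero

theorem norm_toCLM_pos (M : SL(2, ℝ)) (x : UnitCircle) : 0 < ‖toCLM M x‖ :=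
  norm_pos_iff.2 (toCLM_ne_zero M x.coe_ne_zero)

theorem norm_toCLM_le (M : SL(2, ℝ)) (x : UnitCircle) : ‖toCLM M x‖ ≤ opNorm M := by
  simpa [opNorm_eq] using (toCLM M).le_opNorm x

/-- The radial projection of `M x` to the unit circle. -/
noncomputable def act (M : SL(2, ℝ)) (x : UnitCircle) : UnitCircle :=
  ⟨‖toCLM M x‖⁻¹ • toCLM M x, by
    rw [mem_sphere_zero_iff_norm, norm_smul, norm_inv, norm_norm,
      inv_mul_cancel₀ (norm_toCLM_pos M x).ne']⟩

theorem coe_act (M : SL(2, ℝ)) (x : UnitCircle) :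
    (act M x : Plane) = ‖toCLM M x‖⁻¹ • toCLM M x := rfl

theorem norm_toCLM_mul (M N : SL(2, ℝ)) (x : UnitCircle) :
    ‖toCLM (M * N) x‖ = ‖toCLM M (act N x)‖ * ‖toCLM N x‖ := by
  have h := (norm_toCLM_pos N x).ne'
  rw [coe_act, map_smul, norm_smul, norm_inv, norm_norm, toCLM_mul_apply]
  field_simp

theorem act_mul (M N : SL(2, ℝ)) (x : UnitCircle) : act (M * N) x = act M (act N x) := by
  have h := (norm_toCLM_pos N x).ne'
  apply Subtype.ext
  rw [coe_act, norm_toCLM_mul, coe_act M, coe_act N, map_smul, smul_smul, toCLM_mul_apply,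
    mul_inv]

theorem act_one (x : UnitCircle) : act 1 x = x := by
  apply Subtype.ext
  rw [coe_act, toCLM_one]
  simp

theorem act_inv_act (M : SL(2, ℝ)) (x : UnitCircle) : act M⁻¹ (act M x) = x := by
  rw [← act_mul, inv_mul_cancel, act_one]

theorem continuous_toCLM_apply :
    Continuous fun p : SL(2, ℝ) × UnitCircle => toCLM p.1 (p.2 : Plane) :=
  (continuous_toCLM.comp continuous_fst).clm_apply (continuous_subtype_val.comp continuous_snd)

theorem continuous_act : Continuous fun p : SL(2, ℝ) × UnitCircle => act p.1 p.2 :=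
  ((continuous_toCLM_apply.norm.inv₀ fun p => (norm_toCLM_pos p.1 p.2).ne').smul
    continuous_toCLM_apply).subtype_mk _

instance : SecondCountableTopology SL(2, ℝ) :=
  haveI : SecondCountableTopology (Matrix (Fin 2) (Fin 2) ℝ) :=
    inferInstanceAs (SecondCountableTopology (Fin 2 → Fin 2 → ℝ))
  TopologicalSpace.Subtype.secondCountableTopology _

theorem continuous_act_left (x : UnitCircle) : Continuous fun M : SL(2, ℝ) => act M x :=
  Continuous.comp (g := fun p : SL(2, ℝ) × UnitCircle => act p.1 p.2)
    (f := fun M : SL(2, ℝ) => (M, x)) continuous_act (continuous_id.prodMk continuous_const)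

theorem continuous_act_right (M : SL(2, ℝ)) : Continuous fun x : UnitCircle => act M x :=
  Continuous.comp (g := fun p : SL(2, ℝ) × UnitCircle => act p.1 p.2)
    (f := fun x : UnitCircle => (M, x)) continuous_act (continuous_const.prodMk continuous_id)

/-! ### Arc length and its change of variables. -/

/-- The arc length measure on the unit circle. -/
noncomputable def arc : Measure UnitCircle := (volume : Measure Plane).toSphere

instance : IsFiniteMeasure arc := inferInstanceAs (IsFiniteMeasure (Measure.toSphere _))

theorem arc_ne_zero : arc ≠ 0 := Measure.toSphere_ne_zero _

theorem finrank_plane : Module.finrank ℝ Plane = 2 := by simp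

theorem lintegral_plane {Φ : Plane → ℝ≥0∞} (hΦ : Measurable Φ) :
    ∫⁻ v, Φ v = ∫⁻ x : UnitCircle, ∫⁻ r : Set.Ioi (0 : ℝ), Φ ((r : ℝ) • (x : Plane))
      ∂(Measure.volumeIoiPow 1) ∂arc := by
  have hmp := (volume : Measure Plane).measurePreserving_homeomorphUnitSphereProd
  rw [finrank_plane] at hmp
  have hm : Measurable fun p : UnitCircle × Set.Ioi (0 : ℝ) => Φ ((p.2 : ℝ) • (p.1 : Plane)) := by
    fun_prop
  calc ∫⁻ v, Φ v
      = ∫⁻ v : ({0}ᶜ : Set Plane), Φ v ∂(volume.comap Subtype.val) := by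
        rw [lintegral_subtype_comap (measurableSet_singleton _).compl,
          restrict_compl_singleton]
    _ = ∫⁻ v : ({0}ᶜ : Set Plane), (fun p : UnitCircle × Set.Ioi (0 : ℝ) =>
          Φ ((p.2 : ℝ) • (p.1 : Plane))) (homeomorphUnitSphereProd Plane v)
          ∂(volume.comap Subtype.val) := by
        refine lintegral_congr fun v => ?_
        have h : v = (homeomorphUnitSphereProd Plane).symm (homeomorphUnitSphereProd Plane v) := by
          simp
        conv_lhs => rw [h]
        rfl
    _ = ∫⁻ p : UnitCircle × Set.Ioi (0 : ℝ), Φ ((p.2 : ℝ) • (p.1 : Plane))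
          ∂(arc.prod (Measure.volumeIoiPow 1)) := by
        exact hmp.lintegral_comp hm
    _ = _ := lintegral_prod _ hm.aemeasurable

theorem lintegral_toCLM (M : SL(2, ℝ)) {Φ : Plane → ℝ≥0∞} (hΦ : Measurable Φ) :
    ∫⁻ v, Φ (toCLM M v) = ∫⁻ v, Φ v := by
  have hdet : LinearMap.det (toCLM M : Plane →ₗ[ℝ] Plane) = 1 := by
    have h : (toCLM M : Plane →ₗ[ℝ] Plane) = Matrix.toLpLin 2 2 M.1 := rfl
    rw [h, LinearMap.det_toLpLin, M.2]
  have h := Measure.map_linearMap_addHaar_eq_smul_addHaar (volume : Measure Plane)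
    (f := (toCLM M : Plane →ₗ[ℝ] Plane)) (by simp [hdet])
  rw [hdet] at h
  simp only [inv_one, abs_one, ENNReal.ofReal_one, one_smul, ContinuousLinearMap.coe_coe] at h
  conv_rhs => rw [← h]
  rw [lintegral_map hΦ (toCLM M).continuous.measurable]

/-- The extension of `φ` to the punctured unit disc that is constant on rays. -/
noncomputable def radialExt (φ : UnitCircle → ℝ≥0∞) : Plane → ℝ≥0∞ :=
  Function.extend ((↑) : ({0}ᶜ : Set Plane) → Plane)
    (fun v => φ (homeomorphUnitSphereProd Plane v).1 *
      (Metric.ball (0 : Plane) 1).indicator 1 (v : Plane)) 0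

theorem measurable_radialExt {φ : UnitCircle → ℝ≥0∞} (hφ : Measurable φ) :
    Measurable (radialExt φ) := by
  refine (MeasurableEmbedding.subtype_coe
    (measurableSet_singleton _).compl).measurable_extend ?_ measurable_zero
  refine (hφ.comp (continuous_fst.comp (homeomorphUnitSphereProd Plane).continuous).measurable).mul
    ((measurable_one.indicator Metric.isOpen_ball.measurableSet).comp measurable_subtype_coe)

theorem radialExt_smul (φ : UnitCircle → ℝ≥0∞) (M : SL(2, ℝ)) (x : UnitCircle)
    (r : Set.Ioi (0 : ℝ)) :
    radialExt φ (toCLM M ((r : ℝ) • (x : Plane))) = (Set.Iio (⟨‖toCLM M x‖⁻¹,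
      Set.mem_Ioi.2 (inv_pos.2 (norm_toCLM_pos M x))⟩ : Set.Ioi (0 : ℝ))).indicator
        (fun _ => φ (act M x)) r := by
  have hn := norm_toCLM_pos M x
  have hr : (0 : ℝ) < r := r.2
  have hv : toCLM M ((r : ℝ) • (x : Plane)) =
      (((homeomorphUnitSphereProd Plane).symm
        (act M x, ⟨r * ‖toCLM M x‖, mul_pos hr hn⟩) : ({0}ᶜ : Set Plane)) : Plane) := by
    change _ = ((r : ℝ) * ‖toCLM M x‖) • (‖toCLM M x‖⁻¹ • toCLM M x)
    rw [smul_smul, mul_assoc, mul_inv_cancel₀ hn.ne', mul_one, map_smul]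
  have hnorm : ‖toCLM M ((r : ℝ) • (x : Plane))‖ = r * ‖toCLM M x‖ := by
    rw [map_smul, norm_smul, Real.norm_of_nonneg hr.le]
  rw [radialExt, hv, Subtype.val_injective.extend_apply, Homeomorph.apply_symm_apply, ← hv]
  have hiff : toCLM M ((r : ℝ) • (x : Plane)) ∈ Metric.ball (0 : Plane) 1 ↔
      r ∈ Set.Iio (⟨‖toCLM M x‖⁻¹,
        Set.mem_Ioi.2 (inv_pos.2 (norm_toCLM_pos M x))⟩ : Set.Ioi (0 : ℝ)) := by
    rw [mem_ball_zero_iff, hnorm, Set.mem_Iio, ← Subtype.coe_lt_coe, lt_inv_comm₀ hr hn,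
      ← one_div, lt_div_iff₀ hr, mul_comm]
  by_cases h : toCLM M ((r : ℝ) • (x : Plane)) ∈ Metric.ball (0 : Plane) 1
  · rw [Set.indicator_of_mem h, Set.indicator_of_mem (hiff.1 h)]; simp
  · rw [Set.indicator_of_notMem h, Set.indicator_of_notMem (mt hiff.2 h), mul_zero]

/-- The weight `‖M x‖⁻¹`, whose square is the derivative of `act M` at `x`. -/
noncomputable def weight (M : SL(2, ℝ)) (x : UnitCircle) : ℝ≥0∞ := ENNReal.ofReal ‖toCLM M x‖⁻¹

theorem continuous_weight : Continuous fun p : SL(2, ℝ) × UnitCircle => weight p.1 p.2 :=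
  ENNReal.continuous_ofReal.comp
    (continuous_toCLM_apply.norm.inv₀ fun p => (norm_toCLM_pos p.1 p.2).ne')

theorem weight_mul (M N : SL(2, ℝ)) (x : UnitCircle) :
    weight (M * N) x = weight M (act N x) * weight N x := by
  rw [weight, weight, weight, norm_toCLM_mul, mul_inv, ENNReal.ofReal_mul (by positivity)]

theorem weight_one (x : UnitCircle) : weight 1 x = 1 := by simp [weight, toCLM_one]

theorem weight_ne_top (M : SL(2, ℝ)) (x : UnitCircle) : weight M x ≠ ∞ := ENNReal.ofReal_ne_top

/-- In polar coordinates the ray through `x` meets the preimage of the unit disc in `r < ‖M x‖⁻¹`,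
and the integral of `r dr` over this range is `‖M x‖⁻² / 2`. -/
theorem lintegral_radialExt (φ : UnitCircle → ℝ≥0∞) (hφ : Measurable φ) (M : SL(2, ℝ)) :
    ∫⁻ v, radialExt φ (toCLM M v) = ∫⁻ x, φ (act M x) * weight M x ^ 2 * 2⁻¹ ∂arc := by
  rw [lintegral_plane (Φ := fun v => radialExt φ (toCLM M v))
    ((measurable_radialExt hφ).comp (toCLM M).continuous.measurable)]
  refine lintegral_congr fun x => ?_
  simp_rw [radialExt_smul]
  rw [lintegral_indicator measurableSet_Iio, setLIntegral_const, Measure.volumeIoiPow_apply_Iio,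
    mul_assoc]
  congr 1
  rw [weight, ← ENNReal.ofReal_pow (by positivity), div_eq_mul_inv,
    ENNReal.ofReal_mul (by positivity)]
  congr 1
  norm_num
  rw [one_div, ENNReal.ofReal_inv_of_pos (by norm_num)]
  norm_num

/-- Change of variables on the circle. -/
theorem lintegral_act (M : SL(2, ℝ)) {φ : UnitCircle → ℝ≥0∞} (hφ : Measurable φ) :
    ∫⁻ x, φ (act M x) * weight M x ^ 2 ∂arc = ∫⁻ x, φ x ∂arc := by
  have h := lintegral_toCLM M (measurable_radialExt hφ)
  -- As `M` preserves area, the polar integral for `M` equals the one for the identity; the common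
  -- factor `1 / 2` cancels.
  have h1 := lintegral_radialExt φ hφ 1
  simp only [toCLM_one, one_apply_eq_self, act_one, weight_one, one_pow, mul_one] at h1
  rw [lintegral_radialExt φ hφ, h1, lintegral_mul_const' _ _ (by norm_num),
    lintegral_mul_const' _ _ (by norm_num)] at h
  exact (ENNReal.mul_left_inj (by norm_num) (by norm_num)).1 h

/-! ### The twisted isometries and their average. -/

/-- The operator `f ↦ f (M ·) ‖M ·‖⁻¹`, an isometry for the `L²` norm. -/
noncomputable def twist (M : SL(2, ℝ)) (f : UnitCircle → ℝ≥0∞) (x : UnitCircle) : ℝ≥0∞ :=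
  f (act M x) * weight M x

/-- The average of the operators `twist M` with respect to `ν`. -/
noncomputable def transfer (ν : Measure SL(2, ℝ)) (f : UnitCircle → ℝ≥0∞) (x : UnitCircle) :
    ℝ≥0∞ :=
  ∫⁻ M, twist M f x ∂ν

theorem measurable_twist_uncurry {f : UnitCircle → ℝ≥0∞} (hf : Measurable f) :
    Measurable fun p : SL(2, ℝ) × UnitCircle => twist p.1 f p.2 := by
  have h1 : Measurable fun p : SL(2, ℝ) × UnitCircle => act p.1 p.2 := continuous_act.measurable
  have h2 : Measurable fun p : SL(2, ℝ) × UnitCircle => weight p.1 p.2 :=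
    continuous_weight.measurable
  exact Measurable.mul (f := fun p : SL(2, ℝ) × UnitCircle => f (act p.1 p.2)) (hf.comp h1) h2

theorem measurable_twist (M : SL(2, ℝ)) {f : UnitCircle → ℝ≥0∞} (hf : Measurable f) :
    Measurable (twist M f) := by
  have h1 : Measurable fun x : UnitCircle => f (act M x) :=
    hf.comp (continuous_act_right M).measurable
  have h2 : Measurable (weight M) := by
    have h : Continuous fun x : UnitCircle => toCLM M (x : Plane) := by fun_prop
    exact (ENNReal.continuous_ofReal.comp
      (h.norm.inv₀ fun x => (norm_toCLM_pos M x).ne')).measurable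
  exact h1.mul h2

theorem measurable_transfer (ν : Measure SL(2, ℝ)) [SFinite ν] {f : UnitCircle → ℝ≥0∞}
    (hf : Measurable f) : Measurable (transfer ν f) :=
  (measurable_twist_uncurry hf).lintegral_prod_left'

theorem lintegral_twist_sq (M : SL(2, ℝ)) {f : UnitCircle → ℝ≥0∞} (hf : Measurable f) :
    ∫⁻ x, twist M f x ^ 2 ∂arc = ∫⁻ x, f x ^ 2 ∂arc := by
  simp only [twist, mul_pow]
  exact lintegral_act M (hf.pow_const 2)

theorem two_mul_mul_le_sq_add_sq (a b : ℝ≥0∞) {h : ℝ≥0} (hh : h ≠ 0) :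
    2 * (a * b) ≤ h * a ^ 2 + (h⁻¹ : ℝ≥0) * b ^ 2 := by
  have hpos : (0 : ℝ) < h := by positivity
  induction a with
  | top =>
    have : (h : ℝ≥0∞) * ∞ ^ 2 = ∞ := by simp [ENNReal.mul_top, hh]
    rw [this, top_add]; exact le_top
  | coe a =>
    induction b with
    | top =>
      have : ((h⁻¹ : ℝ≥0) : ℝ≥0∞) * ∞ ^ 2 = ∞ := by
        rw [ENNReal.top_pow two_ne_zero]
        exact ENNReal.mul_top (ENNReal.coe_ne_zero.2 (inv_ne_zero hh))
      rw [this, add_top]; exact le_top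
    | coe b =>
      norm_cast
      rw [← NNReal.coe_le_coe]
      push_cast
      have h1 : (h : ℝ) * a ^ 2 + (h : ℝ)⁻¹ * b ^ 2 - 2 * (a * b) = (h : ℝ)⁻¹ * (h * a - b) ^ 2 := by
        field_simp
        ring
      have h2 : 0 ≤ (h : ℝ)⁻¹ * (h * a - b) ^ 2 := by positivity
      linarith

/-- Weighted arithmetic–geometric mean with weight `h (M x)`, followed by the change of variables in
the second term. The free weight is the point: when the left side is almost `2 ‖f‖²`, the inequality
for all `h` makes the measure `f² d(arc)` almost `M`-invariant. -/
theorem two_mul_lintegral_mul_twist_le (M : SL(2, ℝ)) {f : UnitCircle → ℝ≥0∞} (hf : Measurable f)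
    {h : UnitCircle → ℝ≥0} (hh : Measurable h) (h0 : ∀ x, h x ≠ 0) :
    2 * ∫⁻ x, f x * twist M f x ∂arc ≤
      ∫⁻ x, h (act M x) * f x ^ 2 ∂arc + ∫⁻ x, ((h x)⁻¹ : ℝ≥0) * f x ^ 2 ∂arc := by
  have hact := (continuous_act_right M).measurable
  have h2 : ∫⁻ x, ((h x)⁻¹ : ℝ≥0) * f x ^ 2 ∂arc =
      ∫⁻ x, ((h (act M x))⁻¹ : ℝ≥0) * twist M f x ^ 2 ∂arc := by
    rw [← lintegral_act M (by fun_prop)]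
    refine lintegral_congr fun x => ?_
    rw [twist, mul_pow, mul_assoc]
  rw [h2, ← lintegral_add_left (by fun_prop),
    ← lintegral_const_mul (f := fun x => f x * twist M f x) 2 (hf.mul (measurable_twist M hf))]
  exact lintegral_mono fun x => two_mul_mul_le_sq_add_sq _ _ (h0 _)

theorem lintegral_mul_twist_le (M : SL(2, ℝ)) {f : UnitCircle → ℝ≥0∞} (hf : Measurable f) :
    ∫⁻ x, f x * twist M f x ∂arc ≤ ∫⁻ x, f x ^ 2 ∂arc := by
  have h := two_mul_lintegral_mul_twist_le M hf (h := fun _ => 1) measurable_const (by simp)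
  simp only [inv_one, ENNReal.coe_one, one_mul, ← two_mul] at h
  exact (ENNReal.mul_le_mul_iff_right (by norm_num) (by norm_num)).1 h

theorem lintegral_mul_transfer (ν : Measure SL(2, ℝ)) [SFinite ν] {f : UnitCircle → ℝ≥0∞}
    (hf : Measurable f) : ∫⁻ x, f x * transfer ν f x ∂arc =
      ∫⁻ M, ∫⁻ x, f x * twist M f x ∂arc ∂ν := by
  have hm := measurable_twist_uncurry hf
  rw [lintegral_lintegral_swap]
  · refine lintegral_congr fun x => ?_
    exact (lintegral_const_mul _ (hm.comp measurable_prodMk_right)).symm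
  · exact ((hf.comp measurable_snd).mul hm).aemeasurable

/-! ### From almost invariant functions to an invariant measure. -/

/-- A probability measure `μ` with `2 ≤ ∫ h(M x) dμ + ∫ h(x)⁻¹ dμ` for all positive continuous `h`
is `M`-invariant. -/
theorem map_act_eq_of_forall_le (M : SL(2, ℝ)) (μ : Measure UnitCircle) [IsProbabilityMeasure μ]
    (H : ∀ h : UnitCircle → ℝ≥0, Continuous h → (∀ x, h x ≠ 0) →
      2 ≤ ∫⁻ x, h (act M x) ∂μ + ∫⁻ x, ((h x)⁻¹ : ℝ≥0) ∂μ) : μ.map (act M) = μ := by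
  have hact := continuous_act_right M
  have key : ∀ φ : UnitCircle →ᵇ ℝ, ∫ x, φ x ∂μ ≤ ∫ x, φ (act M x) ∂μ := by
    intro φ
    set C := ‖φ‖ + 1 with hC
    have hC0 : 0 < C := by positivity
    have hφ : ∀ x, |φ x| ≤ C := fun x => (φ.norm_coe_le_norm x).trans (by simp [hC])
    have hi1 : Integrable (fun x => φ x) μ := φ.integrable μ
    have hi2 : Integrable (fun x => φ (act M x)) μ :=
      (φ.compContinuous ⟨_, hact⟩).integrable μ
    set A := ∫ x, φ (act M x) ∂μ
    set B := ∫ x, φ x ∂μ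
    -- Test the hypothesis on `h = 1 + ε φ`: the constants cancel and the first-order term in `ε`
    -- gives `B ≤ A`. The bound `ε C < 1 / 2` keeps `h` positive and controls the second-order error
    -- of `h⁻¹`.
    have hlt : ∀ᶠ ε in 𝓝[>] (0 : ℝ), B - A ≤ 2 * ε * C ^ 2 := by
      have : Set.Ioo (0 : ℝ) (1 / (2 * C)) ∈ 𝓝[>] (0 : ℝ) :=
        Ioo_mem_nhdsGT (by positivity)
      filter_upwards [this] with ε hε
      have hε0 := hε.1
      have hεC : ε * C < 1 / 2 := by
        have := hε.2
        rw [lt_div_iff₀ (by positivity)] at this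
        linarith
      have hsmall : ∀ x, |ε * φ x| ≤ ε * C := fun x => by
        rw [abs_mul, abs_of_pos hε0]
        exact mul_le_mul_of_nonneg_left (hφ x) hε0.le
      have hpos : ∀ x, 0 < 1 + ε * φ x := fun x => by
        have := (abs_le.1 (hsmall x)).1
        linarith
      have hinv : ∀ x, (1 + ε * φ x)⁻¹ ≤ 1 - ε * φ x + 2 * ε ^ 2 * C ^ 2 := fun x => by
        rw [inv_le_iff_one_le_mul₀ (hpos x)]
        have h1 := abs_le.1 (hsmall x)
        have h2 : (ε * φ x) ^ 2 ≤ (ε * C) ^ 2 := sq_le_sq' h1.1 h1.2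
        nlinarith [sq_nonneg (ε * C)]
      have h2 := H (fun x => (1 + ε * φ x).toNNReal) (by fun_prop)
        (fun x => (Real.toNNReal_pos.2 (hpos x)).ne')
      have e1 : ∫⁻ x, ((1 + ε * φ (act M x)).toNNReal : ℝ≥0∞) ∂μ = ENNReal.ofReal (1 + ε * A) := by
        change ∫⁻ x, ENNReal.ofReal (1 + ε * φ (act M x)) ∂μ = _
        have hi3 : Integrable (fun x => 1 + ε * φ (act M x)) μ :=
          (integrable_const 1).add (hi2.const_mul ε)
        rw [← ofReal_integral_eq_lintegral_ofReal hi3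
          (ae_of_all _ fun x => (hpos _).le), integral_add (integrable_const 1) (hi2.const_mul ε),
          integral_const_mul]
        simp [A]
      have e2 : ∫⁻ x, (((1 + ε * φ x).toNNReal⁻¹ : ℝ≥0) : ℝ≥0∞) ∂μ ≤
          ENNReal.ofReal (1 - ε * B + 2 * ε ^ 2 * C ^ 2) := by
        have hi3 : Integrable (fun x => 1 - ε * φ x + 2 * ε ^ 2 * C ^ 2) μ :=
          ((integrable_const 1).sub (hi1.const_mul ε)).add (integrable_const _)
        have hnn : ∀ x, 0 ≤ 1 - ε * φ x + 2 * ε ^ 2 * C ^ 2 := fun x =>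
          (inv_nonneg.2 (hpos x).le).trans (hinv x)
        calc ∫⁻ x, (((1 + ε * φ x).toNNReal⁻¹ : ℝ≥0) : ℝ≥0∞) ∂μ
            ≤ ∫⁻ x, ENNReal.ofReal (1 - ε * φ x + 2 * ε ^ 2 * C ^ 2) ∂μ := by
              refine lintegral_mono fun x => ?_
              rw [← Real.toNNReal_inv]
              exact ENNReal.ofReal_le_ofReal (hinv x)
          _ = _ := by
              rw [← ofReal_integral_eq_lintegral_ofReal hi3 (ae_of_all _ hnn),
                integral_add (f := fun x => 1 - ε * φ x)
                  ((integrable_const 1).sub (hi1.const_mul ε)) (integrable_const _),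
                integral_sub (integrable_const 1) (hi1.const_mul ε), integral_const_mul]
              simp [B]
      have hA : |A| ≤ C := by
        refine (norm_integral_le_of_norm_le_const (f := fun x => φ (act M x)) (C := C)
          (ae_of_all μ fun x => hφ (act M x))).trans ?_
        simp
      have hB : |B| ≤ C := by
        refine (norm_integral_le_of_norm_le_const (f := fun x => φ x) (C := C)
          (ae_of_all μ fun x => hφ x)).trans ?_
        simp
      have hA' : 0 ≤ 1 + ε * A := by nlinarith [(abs_le.1 hA).1]
      have hB' : 0 ≤ 1 - ε * B + 2 * ε ^ 2 * C ^ 2 := by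
        nlinarith [(abs_le.1 hB).2, sq_nonneg (ε * C)]
      rw [e1] at h2
      have h3 := h2.trans (add_le_add_right e2 _)
      rw [← ENNReal.ofReal_add hA' hB', ENNReal.le_ofReal_iff_toReal_le (by norm_num)
        (add_nonneg hA' hB')] at h3
      norm_num at h3
      have h4 : ε * (B - A) ≤ ε * (2 * ε * C ^ 2) := by nlinarith
      exact le_of_mul_le_mul_left h4 hε0
    have hlim : Tendsto (fun ε : ℝ => 2 * ε * C ^ 2) (𝓝[>] 0) (𝓝 0) := by
      have : Continuous fun ε : ℝ => 2 * ε * C ^ 2 := by fun_prop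
      simpa using (this.tendsto 0).mono_left nhdsWithin_le_nhds
    linarith [ge_of_tendsto hlim hlt]
  have : IsProbabilityMeasure (μ.map (act M)) :=
    Measure.isProbabilityMeasure_map hact.measurable.aemeasurable
  refine ext_of_forall_integral_eq_of_IsFiniteMeasure fun φ => ?_
  rw [integral_map hact.measurable.aemeasurable φ.continuous.aestronglyMeasurable]
  refine le_antisymm ?_ (key φ)
  have h := key (-φ)
  simp only [BoundedContinuousFunction.coe_neg, Pi.neg_apply, integral_neg] at h
  linarith

/-- If `1` belongs to the closure of the numerical range of the transfer operator, then almost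
every matrix preserves one and the same probability measure on the circle. -/
theorem exists_invariant_measure (ν : Measure SL(2, ℝ)) [IsProbabilityMeasure ν]
    (H : ∀ q : ℝ≥0∞, q < 1 → ∃ f : UnitCircle → ℝ≥0∞, Measurable f ∧
      q * ∫⁻ x, f x ^ 2 ∂arc < ∫⁻ x, f x * transfer ν f x ∂arc) :
    ∃ μ : Measure UnitCircle, IsProbabilityMeasure μ ∧ ∀ᵐ M ∂ν, μ.map (act M) = μ := by
  -- The defects `2⁻¹ ^ (k + 1)` are summable, so that convergence in mean becomes almost sure
  -- convergence below without passing to a subsequence.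
  have hnormal : ∀ k : ℕ, ∃ f : UnitCircle → ℝ≥0∞, Measurable f ∧ ∫⁻ x, f x ^ 2 ∂arc = 1 ∧
      1 - 2⁻¹ ^ (k + 1) ≤ ∫⁻ M, ∫⁻ x, f x * twist M f x ∂arc ∂ν := by
    intro k
    have hq : (1 : ℝ≥0∞) - 2⁻¹ ^ (k + 1) < 1 :=
      ENNReal.sub_lt_self (by simp) (by simp) (by simp)
    have hq0 : (1 : ℝ≥0∞) - 2⁻¹ ^ (k + 1) ≠ 0 := by
      rw [Ne, tsub_eq_zero_iff_le, not_le]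
      exact pow_lt_one₀ zero_le (by simp) (by simp)
    obtain ⟨f, hf, hlt⟩ := H _ hq
    rw [lintegral_mul_transfer ν hf] at hlt
    set I := ∫⁻ x, f x ^ 2 ∂arc with hI
    have hle : ∫⁻ M, ∫⁻ x, f x * twist M f x ∂arc ∂ν ≤ I := by
      calc _ ≤ ∫⁻ _, I ∂ν := lintegral_mono fun M => lintegral_mul_twist_le M hf
        _ = I := by simp
    -- The strict inequality itself excludes `‖f‖² = ∞` and `‖f‖² = 0`, so `f` can be normalised.
    have hItop : I ≠ ∞ := by
      intro h
      rw [h, ENNReal.mul_top hq0] at hlt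
      exact not_top_lt hlt
    have hI0 : I ≠ 0 := by
      intro h
      rw [h] at hle
      rw [h, mul_zero] at hlt
      exact absurd hle (not_le.2 hlt)
    obtain ⟨c, hc⟩ : ∃ c : ℝ≥0∞, c ^ 2 = I⁻¹ := by
      refine ⟨I⁻¹ ^ (1 / 2 : ℝ), ?_⟩
      rw [← ENNReal.rpow_natCast, ← ENNReal.rpow_mul]
      norm_num
    refine ⟨fun x => c * f x, by fun_prop, ?_, ?_⟩
    · simp only [mul_pow]
      rw [lintegral_const_mul _ (by fun_prop), hc, ENNReal.inv_mul_cancel hI0 hItop]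
    · have e : ∀ M x, c * f x * twist M (fun x => c * f x) x = I⁻¹ * (f x * twist M f x) := by
        intro M x
        rw [← hc, twist, twist]
        ring
      simp_rw [e]
      have hctop : I⁻¹ ≠ ∞ := ENNReal.inv_ne_top.2 hI0
      simp_rw [lintegral_const_mul' _ _ hctop]
      rw [mul_comm, ← div_eq_mul_inv, ENNReal.le_div_iff_mul_le (Or.inl hI0) (Or.inl hItop)]
      exact hlt.le
  choose f hf hf1 hfk using hnormal
  set c : ℕ → SL(2, ℝ) → ℝ≥0∞ := fun k M => ∫⁻ x, f k x * twist M (f k) x ∂arc with hc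
  have hcm : ∀ k, Measurable (c k) := fun k =>
    (((hf k).comp measurable_snd).mul (measurable_twist_uncurry (hf k))).lintegral_prod_right'
  have hc1 : ∀ k M, c k M ≤ 1 := fun k M => (lintegral_mul_twist_le M (hf k)).trans (hf1 k).le
  have hdefect : ∀ k, ∫⁻ M, (1 - c k M) ∂ν ≤ 2⁻¹ ^ (k + 1) := by
    intro k
    have hfin : ∫⁻ M, c k M ∂ν ≠ ∞ :=
      ((lintegral_mono (hc1 k)).trans_lt (by simp)).ne
    rw [lintegral_sub (hcm k) hfin (ae_of_all _ (hc1 k)), lintegral_const, measure_univ, mul_one]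
    have h1 : (1 : ℝ≥0∞) - (1 - 2⁻¹ ^ (k + 1)) = 2⁻¹ ^ (k + 1) :=
      ENNReal.sub_sub_cancel ENNReal.one_ne_top (pow_le_one₀ zero_le (by simp))
    rw [← h1]
    exact tsub_le_tsub_left (hfk k) 1
  have hae : ∀ᵐ M ∂ν, Tendsto (fun k => c k M) atTop (𝓝 1) := by
    have hsub : ∀ k, Measurable fun M => 1 - c k M := fun k => measurable_const.sub (hcm k)
    have hsum : ∫⁻ M, ∑' k, (1 - c k M) ∂ν ≠ ∞ := by
      rw [lintegral_tsum fun k => (hsub k).aemeasurable]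
      refine ((ENNReal.tsum_le_tsum hdefect).trans_lt ?_).ne
      rw [ENNReal.tsum_geometric_add_one]
      norm_num
      exact ENNReal.mul_lt_top (by simp) (by simp)
    filter_upwards [ae_lt_top (Measurable.tsum hsub) hsum]
      with M hM
    have h0 := ENNReal.tendsto_atTop_zero_of_tsum_ne_top hM.ne
    have h1 := ENNReal.Tendsto.sub (tendsto_const_nhds (x := (1 : ℝ≥0∞))) h0
      (Or.inl ENNReal.one_ne_top)
    rw [tsub_zero] at h1
    refine h1.congr fun k => ENNReal.sub_sub_cancel ENNReal.one_ne_top (hc1 k M)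
  set μs : ℕ → ProbabilityMeasure UnitCircle := fun k =>
    ⟨arc.withDensity fun x => f k x ^ 2, ⟨by
      rw [withDensity_apply _ MeasurableSet.univ, Measure.restrict_univ, hf1]⟩⟩ with hμs
  -- Probability measures on the compact circle form a compact space. A limit along a nonprincipal
  -- ultrafilter serves as the weak limit.
  obtain ⟨μ, -, hμ⟩ := isCompact_univ.ultrafilter_le_nhds
    ((Filter.hyperfilter ℕ).map μs) (by simp)
  have hμ' : Tendsto μs (Filter.hyperfilter ℕ) (𝓝 μ) := hμ
  refine ⟨μ, inferInstance, ?_⟩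
  filter_upwards [hae] with M hM
  refine map_act_eq_of_forall_le M μ fun h hh h0 => ?_
  have hact := continuous_act_right M
  rw [ProbabilityMeasure.tendsto_iff_forall_lintegral_tendsto] at hμ'
  have t1 := hμ' (BoundedContinuousFunction.mkOfCompact ⟨fun x => h (act M x), hh.comp hact⟩)
  have t2 := hμ' (BoundedContinuousFunction.mkOfCompact ⟨fun x => (h x)⁻¹, hh.inv₀ h0⟩)
  have t3 : Tendsto (fun k => 2 * c k M) (Filter.hyperfilter ℕ) (𝓝 (2 * 1)) :=
    ENNReal.Tendsto.const_mul (hM.mono_left (Nat.hyperfilter_le_atTop)) (Or.inl one_ne_zero)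
  rw [mul_one] at t3
  refine le_of_tendsto_of_tendsto' t3 (t1.add t2) fun k => ?_
  have hk := two_mul_lintegral_mul_twist_le M (hf k) hh.measurable h0
  have hfk2 : Measurable fun x => f k x ^ 2 := (hf k).pow_const 2
  have hhm := hh.measurable
  have ham := hact.measurable
  refine hk.trans_eq ?_
  congr 1
  · refine Eq.symm ((lintegral_withDensity_eq_lintegral_mul arc hfk2
      (g := fun x => (h (act M x) : ℝ≥0∞)) (by fun_prop)).trans ?_)
    exact lintegral_congr fun x => mul_comm _ _
  · refine Eq.symm ((lintegral_withDensity_eq_lintegral_mul arc hfk2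
      (g := fun x => (((h x)⁻¹ : ℝ≥0) : ℝ≥0∞)) (by fun_prop)).trans ?_)
    exact lintegral_congr fun x => mul_comm _ _

/-! ### Exponential decay under a gap. -/

theorem sq_lintegral_le {α : Type*} [MeasurableSpace α] (ν : Measure α) [IsProbabilityMeasure ν]
    {h : α → ℝ≥0∞} (hh : Measurable h) : (∫⁻ a, h a ∂ν) ^ 2 ≤ ∫⁻ a, h a ^ 2 ∂ν := by
  have hle : 2 * (∫⁻ a, h a ∂ν) ^ 2 ≤ 2 * ∫⁻ a, h a ^ 2 ∂ν := by
    calc 2 * (∫⁻ a, h a ∂ν) ^ 2 = ∫⁻ a, ∫⁻ b, 2 * (h a * h b) ∂ν ∂ν := by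
          simp_rw [lintegral_const_mul 2 (Measurable.const_mul hh _), lintegral_const_mul _ hh]
          rw [lintegral_const_mul _ (hh.mul_const _), lintegral_mul_const _ hh, sq]
      _ ≤ ∫⁻ a, ∫⁻ b, (h a ^ 2 + h b ^ 2) ∂ν ∂ν := by
          refine lintegral_mono fun a => lintegral_mono fun b => ?_
          simpa using two_mul_mul_le_sq_add_sq (h a) (h b) one_ne_zero
      _ = 2 * ∫⁻ a, h a ^ 2 ∂ν := by
          simp_rw [lintegral_add_left (measurable_const (a := h _ ^ 2)), lintegral_const,
            measure_univ, mul_one]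
          rw [lintegral_add_left (hh.pow_const 2), lintegral_const, measure_univ, mul_one, two_mul]
  exact (ENNReal.mul_le_mul_iff_right (by norm_num) (by norm_num)).1 hle

/-- An average of isometries is a contraction. This keeps the `L²` norms below finite, so that they
can be cancelled. -/
theorem lintegral_transfer_sq_le (ν : Measure SL(2, ℝ)) [IsProbabilityMeasure ν]
    {f : UnitCircle → ℝ≥0∞} (hf : Measurable f) :
    ∫⁻ x, transfer ν f x ^ 2 ∂arc ≤ ∫⁻ x, f x ^ 2 ∂arc := by
  have hm := measurable_twist_uncurry hf
  have hmx : ∀ x, Measurable fun M => twist M f x := fun x =>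
    Measurable.comp (g := fun p : SL(2, ℝ) × UnitCircle => twist p.1 f p.2)
      (f := fun M : SL(2, ℝ) => (M, x)) hm measurable_prodMk_right
  have hsw : Measurable fun p : UnitCircle × SL(2, ℝ) => twist p.2 f p.1 ^ 2 :=
    (Measurable.comp (g := fun p : SL(2, ℝ) × UnitCircle => twist p.1 f p.2)
      (f := Prod.swap) hm measurable_swap).pow_const 2
  calc ∫⁻ x, transfer ν f x ^ 2 ∂arc
      ≤ ∫⁻ x, ∫⁻ M, twist M f x ^ 2 ∂ν ∂arc := lintegral_mono fun x => sq_lintegral_le ν (hmx x)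
    _ = ∫⁻ M, ∫⁻ x, twist M f x ^ 2 ∂arc ∂ν :=
        lintegral_lintegral_swap hsw.aemeasurable
    _ = ∫⁻ x, f x ^ 2 ∂arc := by simp_rw [lintegral_twist_sq _ hf]; simp

theorem transfer_mono (ν : Measure SL(2, ℝ)) {f g : UnitCircle → ℝ≥0∞} (h : f ≤ g) :
    transfer ν f ≤ transfer ν g :=
  fun x => lintegral_mono fun M => mul_le_mul_left (h (act M x)) _

theorem transfer_const_mul (ν : Measure SL(2, ℝ)) {c : ℝ≥0∞} (hc : c ≠ ∞)
    (f : UnitCircle → ℝ≥0∞) (x : UnitCircle) :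
    transfer ν (fun y => c * f y) x = c * transfer ν f x := by
  simp only [transfer, twist, mul_assoc]
  rw [lintegral_const_mul' _ _ hc]

/-- If the numerical range of the transfer operator stays away from `1`, its powers decay
exponentially. -/
theorem exists_transfer_iterate_decay (ν : Measure SL(2, ℝ)) [IsProbabilityMeasure ν] {q : ℝ≥0∞}
    (hq : q < 1) (hgap : ∀ f : UnitCircle → ℝ≥0∞, Measurable f →
      ∫⁻ x, f x * transfer ν f x ∂arc ≤ q * ∫⁻ x, f x ^ 2 ∂arc) :
    ∃ s : ℝ≥0∞, 1 < s ∧ s ≠ ∞ ∧ ∃ C : ℝ≥0∞, C ≠ ∞ ∧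
      ∀ n, s ^ n * ∫⁻ x, (transfer ν)^[n] 1 x ∂arc ≤ C := by
  obtain ⟨s, hs1, hsq⟩ := exists_between (ENNReal.one_lt_inv.2 hq)
  have hs_top : s ≠ ∞ := hsq.ne_top
  have hsq1 : s * q < 1 := ENNReal.mul_lt_of_lt_div (by rwa [one_div])
  obtain ⟨η, hη⟩ : ∃ η : ℝ≥0, (η : ℝ≥0∞) = 1 - s * q :=
    ⟨(1 - s * q).toNNReal, ENNReal.coe_toNNReal (by finiteness)⟩
  have hη0 : η ≠ 0 := by
    intro h
    rw [h, ENNReal.coe_zero, eq_comm, tsub_eq_zero_iff_le] at hη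
    exact absurd hη (not_le.2 hsq1)
  have hη1 : (η : ℝ≥0∞) + s * q = 1 := by rw [hη, tsub_add_cancel_of_le hsq1.le]
  -- The iterates of `Q` at `0` are the partial sums of the Neumann series `∑ s ^ j transfer^j 1`,
  -- where `1 < s < q⁻¹`. Bounding their integrals uniformly bounds each term, with no
  -- self-adjointness of `transfer` needed.
  set Q : (UnitCircle → ℝ≥0∞) → UnitCircle → ℝ≥0∞ := fun f x => 1 + s * transfer ν f x with hQ
  have hQmono : Monotone Q := fun f g h x =>
    add_le_add_right (mul_le_mul_right (transfer_mono ν h x) s) 1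
  have hF : ∀ n, Measurable (Q^[n] 0) ∧ ∫⁻ x, (Q^[n] 0) x ^ 2 ∂arc ≠ ∞ := by
    intro n
    induction n with
    | zero => exact ⟨measurable_zero, by simp⟩
    | succ n ih =>
      have hm := measurable_transfer ν ih.1
      rw [Function.iterate_succ_apply']
      refine ⟨measurable_const.add (hm.const_mul s), ?_⟩
      have hb : ∀ x, Q (Q^[n] 0) x ^ 2 ≤ 2 + 2 * s ^ 2 * transfer ν (Q^[n] 0) x ^ 2 := by
        intro x
        have h2 := two_mul_mul_le_sq_add_sq 1 (s * transfer ν (Q^[n] 0) x) one_ne_zero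
        simp only [ENNReal.coe_one, one_pow, mul_one, one_mul, inv_one] at h2
        calc Q (Q^[n] 0) x ^ 2
            = 1 + 2 * (s * transfer ν (Q^[n] 0) x) + (s * transfer ν (Q^[n] 0) x) ^ 2 := by
              simp only [hQ]; ring
          _ ≤ 1 + (1 + (s * transfer ν (Q^[n] 0) x) ^ 2) + (s * transfer ν (Q^[n] 0) x) ^ 2 := by
              gcongr
          _ = _ := by ring
      refine ((lintegral_mono hb).trans_lt ?_).ne
      rw [lintegral_add_left measurable_const, lintegral_const_mul _ (hm.pow_const 2)]
      have := (lintegral_transfer_sq_le ν ih.1).trans_lt (lt_top_iff_ne_top.2 ih.2)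
      rw [lintegral_const]
      finiteness
  have hbound : ∀ n, ∫⁻ x, (Q^[n] 0) x ∂arc ≤ (η⁻¹ : ℝ≥0) * arc Set.univ := by
    intro n
    obtain ⟨hm, hfin⟩ := hF n
    set F := Q^[n] 0 with hFn
    -- Positivity makes the partial sums increase. Multiplying `F ≤ Q F` by `F` and integrating
    -- gives `(1 - s q) ‖F‖² ≤ ∫ F` by the gap, and Young's inequality with weight `η = 1 - s q`
    -- closes the estimate.
    have hFle : F ≤ Q F := by
      have := hQmono.monotone_iterate_of_le_map (x := 0) (fun x => zero_le) (Nat.le_succ n)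
      simpa only [Function.iterate_succ_apply'] using this
    set I := ∫⁻ x, F x ^ 2 ∂arc
    have hyoung : 2 * ∫⁻ x, F x ∂arc ≤ η * I + (η⁻¹ : ℝ≥0) * arc Set.univ := by
      calc 2 * ∫⁻ x, F x ∂arc = ∫⁻ x, 2 * (F x * 1) ∂arc := by
            simp only [mul_one]; rw [lintegral_const_mul _ hm]
        _ ≤ ∫⁻ x, (η * F x ^ 2 + (η⁻¹ : ℝ≥0) * 1 ^ 2) ∂arc :=
            lintegral_mono fun x => two_mul_mul_le_sq_add_sq _ _ hη0
        _ = _ := by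
            rw [lintegral_add_left (by fun_prop), lintegral_const_mul _ (hm.pow_const 2),
              lintegral_const, one_pow, mul_one]
    have hJ : ∫⁻ x, F x ∂arc ≠ ∞ := by
      intro h
      rw [h, ENNReal.mul_top two_ne_zero, top_le_iff] at hyoung
      have : η * I + (η⁻¹ : ℝ≥0) * arc Set.univ ≠ ∞ := by finiteness
      exact this hyoung
    have hI : I ≤ ∫⁻ x, F x ∂arc + s * q * I := by
      calc I ≤ ∫⁻ x, (F x + s * (F x * transfer ν F x)) ∂arc := by
            refine lintegral_mono fun x => ?_
            calc F x ^ 2 = F x * F x := sq _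
              _ ≤ F x * Q F x := mul_le_mul_right (hFle x) _
              _ = _ := by simp only [hQ]; ring
        _ = ∫⁻ x, F x ∂arc + s * ∫⁻ x, F x * transfer ν F x ∂arc := by
            rw [lintegral_add_left hm, lintegral_const_mul' _ _ hs_top]
        _ ≤ ∫⁻ x, F x ∂arc + s * (q * I) := by gcongr; exact hgap F hm
        _ = _ := by rw [mul_assoc]
    have hηI : η * I ≤ ∫⁻ x, F x ∂arc := by
      have h1 : η * I + s * q * I ≤ ∫⁻ x, F x ∂arc + s * q * I := by
        rwa [← add_mul, hη1, one_mul]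
      exact (ENNReal.add_le_add_iff_right (by finiteness)).1 h1
    have h2 := hyoung.trans (add_le_add_left hηI _)
    rw [two_mul] at h2
    exact (ENNReal.add_le_add_iff_left hJ).1 h2
  refine ⟨s, hs1, hs_top, (η⁻¹ : ℝ≥0) * arc Set.univ, by finiteness, fun n => ?_⟩
  have hlow : ∀ n x, s ^ n * (transfer ν)^[n] 1 x ≤ (Q^[n + 1] 0) x := by
    intro n
    induction n with
    | zero => intro x; simp [hQ]
    | succ n ih =>
      intro x
      have hsn : s ^ n ≠ ∞ := by finiteness
      rw [Function.iterate_succ_apply' (transfer ν), Function.iterate_succ_apply' Q (n + 1),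
        pow_succ', mul_assoc, ← transfer_const_mul ν hsn]
      exact (mul_le_mul_right (transfer_mono ν ih x) s).trans le_add_self
  rw [← lintegral_const_mul' _ _ (by finiteness)]
  exact (lintegral_mono (hlow n)).trans (hbound (n + 1))

/-! ### Area form, lines, and measures invariant under an unbounded group. -/

/-- The area form of the plane. -/
def area (v w : Plane) : ℝ := v 0 * w 1 - v 1 * w 0

theorem continuous_area : Continuous fun p : Plane × Plane => area p.1 p.2 := by
  unfold area; fun_prop

theorem area_smul_left (c : ℝ) (v w : Plane) : area (c • v) w = c * area v w := by
  simp [area]; ring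

theorem area_smul_right (c : ℝ) (v w : Plane) : area v (c • w) = c * area v w := by
  simp [area]; ring

theorem area_sub_left (u v w : Plane) : area (u - v) w = area u w - area v w := by
  simp [area]; ring

theorem abs_area_le (v w : Plane) : |area v w| ≤ 2 * ‖v‖ * ‖w‖ := by
  have h : ∀ (u : Plane) i, |u i| ≤ ‖u‖ := fun u i => PiLp.norm_apply_le u i
  calc |area v w| ≤ |v 0 * w 1| + |v 1 * w 0| := abs_sub _ _
    _ = |v 0| * |w 1| + |v 1| * |w 0| := by rw [abs_mul, abs_mul]
    _ ≤ ‖v‖ * ‖w‖ + ‖v‖ * ‖w‖ := by gcongr <;> exact h _ _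
    _ = _ := by ring

theorem area_toCLM (M : SL(2, ℝ)) (v w : Plane) : area (toCLM M v) (toCLM M w) = area v w := by
  have hdet : (M : Matrix (Fin 2) (Fin 2) ℝ) 0 0 * (M : Matrix (Fin 2) (Fin 2) ℝ) 1 1 -
      (M : Matrix (Fin 2) (Fin 2) ℝ) 0 1 * (M : Matrix (Fin 2) (Fin 2) ℝ) 1 0 = 1 := by
    rw [← Matrix.det_fin_two]; exact M.2
  simp only [area, ofLp_toCLM, Matrix.mulVec, dotProduct, Fin.sum_univ_two]
  linear_combination (v 0 * w 1 - v 1 * w 0) * hdet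

theorem area_smul_eq (u v w : Plane) : area u v • w = area w v • u + area u w • v := by
  ext i
  fin_cases i <;> simp [area] <;> ring

/-- The line spanned by a nonzero vector of the plane. -/
noncomputable def line (v : Plane) (hv : v ≠ 0) : Directions :=
  Projectivization.mk ℝ v.ofLp (by simpa using hv)

theorem line_eq_of_area_eq_zero {v w : Plane} (hv : v ≠ 0) (hw : w ≠ 0) (h : area v w = 0) :
    line v hv = line w hw := by
  rw [line, line, Projectivization.mk_eq_mk_iff']
  rw [area, sub_eq_zero] at h
  by_cases h0 : w 0 = 0
  · have h1 : w 1 ≠ 0 := by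
      intro h1
      apply hw
      ext i
      fin_cases i <;> simp [h0, h1]
    have hv0 : v 0 = 0 := by simpa [h0, h1] using h
    refine ⟨v 1 / w 1, ?_⟩
    ext i
    fin_cases i
    · simp [h0, hv0]
    · simp [h1]
  · refine ⟨v 0 / w 0, ?_⟩
    ext i
    fin_cases i
    · simp [h0]
    · simp only [Fin.mk_one, Pi.smul_apply, smul_eq_mul]
      field_simp
      linarith

theorem line_act (M : SL(2, ℝ)) (x : UnitCircle) :
    line (act M x) (act M x).coe_ne_zero = M • line x x.coe_ne_zero := by
  have h : M • line x x.coe_ne_zero = Projectivization.mk ℝ (toCLM M x).ofLp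
      (by simpa using toCLM_ne_zero M x.coe_ne_zero) := rfl
  rw [h]
  exact (Projectivization.mk_eq_mk_iff' ..).2 ⟨‖toCLM M x‖⁻¹, rfl⟩

/-- `SL(2, ℝ)` is closed in the space of matrices, where norm balls are compact. -/
theorem exists_lt_opNorm_of_not_isCompact {G : Subgroup SL(2, ℝ)}
    (hG : IsClosed (G : Set SL(2, ℝ))) (hnc : ¬ IsCompact (G : Set SL(2, ℝ))) (C : ℝ) :
    ∃ M ∈ G, C < opNorm M := by
  by_contra! H
  apply hnc
  have hemb : IsClosedEmbedding
      (Subtype.val : SL(2, ℝ) → Matrix (Fin 2) (Fin 2) ℝ) := by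
    refine IsClosed.isClosedEmbedding_subtypeVal ?_
    exact isClosed_eq (Continuous.matrix_det continuous_id) continuous_const
  let e : Matrix (Fin 2) (Fin 2) ℝ ≃L[ℝ] (Plane →L[ℝ] Plane) :=
    (Matrix.toEuclideanCLM (n := Fin 2) (𝕜 := ℝ)).toAlgEquiv.toLinearEquiv.toContinuousLinearEquiv
  have hK : IsCompact (Subtype.val ⁻¹' (e ⁻¹' Metric.closedBall 0 C) : Set SL(2, ℝ)) :=
    hemb.isCompact_preimage
      (e.toHomeomorph.isCompact_preimage.2 (isCompact_closedBall _ _))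
  refine hK.of_isClosed_subset hG fun M hM => ?_
  have h : ‖e M.1‖ ≤ C := H M hM
  exact mem_closedBall_zero_iff.2 h

/-- A probability measure on the circle that is invariant under matrices of arbitrarily large norm
is carried by at most two lines. -/
theorem exists_ae_line_eq (g : ℕ → SL(2, ℝ)) (hg : ∀ n : ℕ, (n : ℝ) < opNorm (g n))
    (μ : Measure UnitCircle) [IsProbabilityMeasure μ] (hμ : ∀ n, μ.map (act (g n)) = μ) :
    ∃ l₁ l₂ : Directions, ∀ᵐ x : UnitCircle ∂μ,
      line x x.coe_ne_zero = l₁ ∨ line x x.coe_ne_zero = l₂ := by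
  set A : ℕ → Plane →L[ℝ] Plane := fun n => (opNorm (g n))⁻¹ • toCLM (g n) with hA
  have hAS : ∀ n, A n ∈ Metric.sphere (0 : Plane →L[ℝ] Plane) 1 := fun n => by
    rw [mem_sphere_zero_iff_norm, norm_smul, norm_inv, Real.norm_of_nonneg (opNorm_pos _).le,
      ← opNorm_eq, inv_mul_cancel₀ (opNorm_pos _).ne']
  obtain ⟨B, hB, k, hk, hlim⟩ := (isCompact_sphere _ _).tendsto_subseq hAS
  -- The limit `B` of the normalised matrices has norm `1`, but the areas of images under `A n` are
  -- scaled by `‖g n‖⁻²`, which tends to `0`; so `B` has rank one.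
  have hBx : ∀ v, Tendsto (fun n => A (k n) v) atTop (𝓝 (B v)) := fun v =>
    ((ContinuousLinearMap.apply ℝ Plane v).continuous.tendsto B).comp hlim
  have harea : ∀ v w, area (B v) (B w) = 0 := by
    intro v w
    have h1 : Tendsto (fun n => area (A (k n) v) (A (k n) w)) atTop (𝓝 (area (B v) (B w))) :=
      (continuous_area.tendsto (B v, B w)).comp ((hBx v).prodMk_nhds (hBx w))
    have h2 : Tendsto (fun n => area (A (k n) v) (A (k n) w)) atTop (𝓝 0) := by
      have h3 : Tendsto (fun n => (opNorm (g (k n)))⁻¹) atTop (𝓝 0) := by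
        refine Tendsto.inv_tendsto_atTop ?_
        exact tendsto_atTop_mono (fun n => (hg (k n)).le)
          (tendsto_natCast_atTop_atTop.comp hk.tendsto_atTop)
      have h4 := (h3.mul h3).mul_const (area v w)
      rw [mul_zero, zero_mul] at h4
      refine h4.congr fun n => ?_
      simp only [hA, smul_apply, area_smul_left, area_smul_right, area_toCLM]
      ring
    exact tendsto_nhds_unique h1 h2
  obtain ⟨v₀, hv₀⟩ : ∃ v, B v ≠ 0 := by
    by_contra! h
    have : B = 0 := ContinuousLinearMap.ext h
    simp [this] at hB
  -- the lines on which the limit vanishes are all equal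
  obtain ⟨q, hq⟩ : ∃ q : UnitCircle, ∀ x : UnitCircle, B x = 0 → area q x = 0 := by
    by_cases h : ∃ q : UnitCircle, B q = 0
    · obtain ⟨q, hq⟩ := h
      refine ⟨q, fun x hx => ?_⟩
      -- The linear relation between three plane vectors, mapped by `B`, leaves only `area q x • B
      -- v₀ = 0`.
      have h1 := congrArg B (area_smul_eq q x v₀)
      simp only [map_add, map_smul, hx, hq, smul_zero, add_zero, smul_eq_zero] at h1
      exact h1.resolve_right hv₀
    · push Not at h
      have hn : (‖v₀‖⁻¹ • v₀ : Plane) ∈ Metric.sphere (0 : Plane) 1 := by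
        have : ‖v₀‖ ≠ 0 := by
          rw [norm_ne_zero_iff]; rintro rfl; simp at hv₀
        rw [mem_sphere_zero_iff_norm, norm_smul, norm_inv, norm_norm, inv_mul_cancel₀ this]
      exact ⟨⟨_, hn⟩, fun x hx => absurd hx (h x)⟩
  obtain ⟨p, -, j, hj, hp⟩ := isCompact_univ.tendsto_subseq
    (x := fun n => act (g (k n)) q) (fun _ => Set.mem_univ _)
  set r : ℕ → SL(2, ℝ) := fun n => g (k (j n)) with hr
  -- `D` vanishes exactly on the image line of `B` and the line of `p`. Points outside the kernel of
  -- `B` are driven to the former; points of the kernel move along the line of `act (r n) q`, which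
  -- tends to the latter. Invariance of `μ` and dominated convergence then give `∫ D dμ = 0`.
  set D : UnitCircle → ℝ := fun y => |area (B v₀) y| * |area p y| with hD
  have hDc : Continuous D := by
    have h : ∀ v : Plane, Continuous fun y : UnitCircle => area v y := fun v =>
      continuous_area.comp (continuous_const.prodMk continuous_subtype_val)
    exact (h _).abs.mul (h _).abs
  have hDlim : ∀ x, Tendsto (fun n => D (act (r n) x)) atTop (𝓝 0) := by
    intro x
    by_cases hx : B x = 0
    · have hz : ∀ n, area (act (r n) q) (act (r n) x) = 0 := fun n => by
        rw [coe_act, coe_act, area_smul_left, area_smul_right, area_toCLM, hq x hx, mul_zero,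
          mul_zero]
      have hb : ∀ n, D (act (r n) x) ≤
          (2 * ‖B v₀‖ * 1) * (2 * ‖(p : Plane) - act (r n) q‖ * 1) := fun n => by
        have h1 := abs_area_le (B v₀) (act (r n) x)
        have h2 := abs_area_le ((p : Plane) - act (r n) q) (act (r n) x)
        rw [area_sub_left, hz, sub_zero] at h2
        rw [UnitCircle.norm_coe] at h1 h2
        exact mul_le_mul h1 h2 (abs_nonneg _) (by positivity)
      have h0 : Tendsto (fun n => (2 * ‖B v₀‖ * 1) * (2 * ‖(p : Plane) - act (r n) q‖ * 1))
          atTop (𝓝 0) := by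
        have h1 : Tendsto (fun n => ((act (r n) q : UnitCircle) : Plane)) atTop (𝓝 (p : Plane)) :=
          (continuous_subtype_val.tendsto p).comp hp
        have h2 := (((tendsto_const_nhds (x := (p : Plane))).sub h1).norm.const_mul 2).mul_const 1
        simpa using h2.const_mul (2 * ‖B v₀‖ * 1)
      exact squeeze_zero (fun n => by positivity) hb h0
    · have e : ∀ n, |area (B v₀) (act (r n) x)| =
          ‖A (k (j n)) x‖⁻¹ * |area (B v₀) (A (k (j n)) x)| := fun n => by
        have hN := opNorm_pos (r n)
        simp only [hA, smul_apply, coe_act, area_smul_right, abs_mul,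
          norm_smul, norm_inv, abs_inv, Real.norm_eq_abs, abs_norm]
        rw [abs_of_pos hN]
        field_simp
        rfl
      have hl := (hBx x).comp hj.tendsto_atTop
      have h1 : Tendsto (fun n => |area (B v₀) (act (r n) x)|) atTop (𝓝 0) := by
        have h2 : Tendsto (fun n => area (B v₀) (A (k (j n)) x)) atTop
            (𝓝 (area (B v₀) (B x))) :=
          (continuous_area.tendsto (B v₀, B x)).comp (tendsto_const_nhds.prodMk_nhds hl)
        have h3 := (hl.norm.inv₀ (norm_ne_zero_iff.2 hx)).mul h2.abs
        rw [harea, abs_zero, mul_zero] at h3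
        exact h3.congr fun n => (e n).symm
      have hb : ∀ n, D (act (r n) x) ≤ |area (B v₀) (act (r n) x)| * 2 := fun n => by
        have h2 := abs_area_le p (act (r n) x)
        rw [UnitCircle.norm_coe, UnitCircle.norm_coe] at h2
        exact mul_le_mul_of_nonneg_left (by linarith) (abs_nonneg _)
      exact squeeze_zero (fun n => by positivity) hb (by simpa using h1.mul_const 2)
  have hint : ∀ n, ∫ x, D (act (r n) x) ∂μ = ∫ x, D x ∂μ := fun n => by
    have ham := (continuous_act_right (r n)).measurable.aemeasurable (μ := μ)
    conv_rhs => rw [← hμ (k (j n))]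
    rw [integral_map ham hDc.aestronglyMeasurable]
  have hDle : ∀ x, ‖D x‖ ≤ 4 * ‖B v₀‖ := fun x => by
    have h1 := abs_area_le (B v₀) x
    have h2 := abs_area_le p x
    rw [UnitCircle.norm_coe] at h1 h2
    rw [UnitCircle.norm_coe] at h2
    rw [Real.norm_of_nonneg (by positivity)]
    calc D x ≤ (2 * ‖B v₀‖ * 1) * (2 * 1 * 1) := mul_le_mul h1 h2 (abs_nonneg _) (by positivity)
      _ = _ := by ring
  have hzero : ∫ x, D x ∂μ = 0 := by
    have h := tendsto_integral_of_dominated_convergence (μ := μ)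
      (F := fun n x => D (act (r n) x)) (f := fun _ => 0) (fun _ => 4 * ‖B v₀‖)
      (fun n => (hDc.comp (continuous_act_right (r n))).aestronglyMeasurable)
      (integrable_const _) (fun n => ae_of_all _ fun x => hDle _) (ae_of_all _ hDlim)
    simp only [hint, integral_zero] at h
    exact tendsto_nhds_unique tendsto_const_nhds h
  have hDi : Integrable D μ :=
    (integrable_const (4 * ‖B v₀‖)).mono' hDc.aestronglyMeasurable (ae_of_all _ hDle)
  rw [integral_eq_zero_iff_of_nonneg (fun x => by positivity) hDi] at hzero
  refine ⟨line (B v₀) hv₀, line p p.coe_ne_zero, ?_⟩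
  filter_upwards [hzero] with x hx
  simp only [hD, Pi.zero_apply, mul_eq_zero, abs_eq_zero] at hx
  exact hx.imp (fun h => (line_eq_of_area_eq_zero _ _ h).symm)
    fun h => (line_eq_of_area_eq_zero _ _ h).symm

theorem exists_isInvariantSet_of_invariant_measure {G : Subgroup SL(2, ℝ)}
    (hG : IsClosed (G : Set SL(2, ℝ))) (hnc : ¬ IsCompact (G : Set SL(2, ℝ)))
    (μ : Measure UnitCircle) [IsProbabilityMeasure μ] (hμ : ∀ M ∈ G, μ.map (act M) = μ) :
    ∃ L : Set Directions, (L.ncard = 1 ∨ L.ncard = 2) ∧ IsInvariantSet G L := by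
  choose g hgG hg using fun n : ℕ => exists_lt_opNorm_of_not_isCompact hG hnc n
  obtain ⟨l₁, l₂, hl⟩ := exists_ae_line_eq g hg μ fun n => hμ _ (hgG n)
  set S : Directions → Set UnitCircle := fun l => {x | line x x.coe_ne_zero = l} with hS
  set L : Set Directions := {l | μ (S l) ≠ 0} with hL
  have hsub : L ⊆ {l₁, l₂} := by
    intro l hlL
    by_contra hne
    apply hlL
    simp only [Set.mem_insert_iff, Set.mem_singleton_iff, not_or] at hne
    have hs : S l ⊆ {x | ¬ (line x x.coe_ne_zero = l₁ ∨ line x x.coe_ne_zero = l₂)} := by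
      intro x hx h
      have hx' : line x x.coe_ne_zero = l := hx
      rw [hx'] at h
      exact h.elim hne.1 hne.2
    exact measure_mono_null hs (ae_iff.1 hl)
  have hne : L.Nonempty := by
    by_contra h
    rw [Set.not_nonempty_iff_eq_empty, Set.eq_empty_iff_forall_notMem] at h
    have h1 : μ (S l₁ ∪ S l₂) = 0 :=
      measure_union_null (not_not.1 (h l₁)) (not_not.1 (h l₂))
    have h2 : μ (S l₁ ∪ S l₂)ᶜ = 0 := ae_iff.1 hl
    have h3 : μ Set.univ = 0 := by
      rw [← Set.union_compl_self (S l₁ ∪ S l₂)]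
      exact measure_union_null h1 h2
    simp at h3
  have hmap : ∀ M ∈ G, ∀ l ∈ L, M • l ∈ L := by
    intro M hM l hlL h0
    apply hlL
    -- This inequality holds for arbitrary sets, so the sets `S l` need not be shown measurable.
    have h1 := Measure.le_map_apply (μ := μ) (continuous_act_right M).measurable.aemeasurable
      (S (M • l))
    rw [hμ M hM, h0, nonpos_iff_eq_zero] at h1
    refine measure_mono_null (fun x hx => ?_) h1
    change line _ _ = _
    rw [line_act]
    exact congrArg (M • ·) hx
  refine ⟨L, ?_, fun M hM => ?_⟩
  · have hfin : ({l₁, l₂} : Set Directions).Finite := Set.toFinite _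
    have h1 : L.ncard ≤ 2 := (Set.ncard_le_ncard hsub hfin).trans
      ((Set.ncard_insert_le _ _).trans (by rw [Set.ncard_singleton]))
    have h2 : 0 < L.ncard := (Set.ncard_pos (hfin.subset hsub)).2 hne
    omega
  · refine Set.Subset.antisymm ?_ fun l hlL => ?_
    · rintro _ ⟨l, hlL, rfl⟩
      exact hmap M hM l hlL
    · exact ⟨M⁻¹ • l, hmap _ (G.inv_mem hM) l hlL, smul_inv_smul M l⟩

/-- The matrices that preserve a measure on the circle. -/
noncomputable def measureStabilizer (μ : Measure UnitCircle) : Subgroup SL(2, ℝ) where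
  carrier := {M | μ.map (act M) = μ}
  one_mem' := by
    have h : act 1 = id := funext act_one
    change μ.map (act 1) = μ
    rw [h, Measure.map_id]
  mul_mem' {M N} hM hN := by
    change μ.map (act (M * N)) = μ
    have h : act (M * N) = act M ∘ act N := funext (act_mul M N)
    rw [h, ← Measure.map_map (continuous_act_right M).measurable
      (continuous_act_right N).measurable, hN, hM]
  inv_mem' {M} hM := by
    change μ.map (act M⁻¹) = μ
    have h : act M⁻¹ ∘ act M = id := funext (act_inv_act M)
    conv_lhs => rw [← hM]
    rw [Measure.map_map (continuous_act_right M⁻¹).measurable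
      (continuous_act_right M).measurable, h, Measure.map_id]

/-- Invariance is tested on continuous functions `φ`, and `∫ φ (M x) dμ` is continuous in `M`.
Closedness carries invariance from almost every `M` to the support of `ν`, and hence to `G_ν`. -/
theorem isClosed_measureStabilizer (μ : Measure UnitCircle) [IsProbabilityMeasure μ] :
    IsClosed (measureStabilizer μ : Set SL(2, ℝ)) := by
  have h : (measureStabilizer μ : Set SL(2, ℝ)) =
      ⋂ φ : UnitCircle →ᵇ ℝ, {M | ∫ x, φ (act M x) ∂μ = ∫ x, φ x ∂μ} := by
    ext M
    have ham := (continuous_act_right M).measurable.aemeasurable (μ := μ)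
    simp only [Set.mem_iInter, Set.mem_ofPred_eq]
    refine ⟨fun hM φ => ?_, fun hM => ?_⟩
    · change μ.map (act M) = μ at hM
      conv_rhs => rw [← hM]
      rw [integral_map ham φ.continuous.aestronglyMeasurable]
    · have : IsProbabilityMeasure (μ.map (act M)) := Measure.isProbabilityMeasure_map ham
      refine ext_of_forall_integral_eq_of_IsFiniteMeasure fun φ => ?_
      rw [integral_map ham φ.continuous.aestronglyMeasurable, hM]
  rw [h]
  refine isClosed_iInter fun φ => isClosed_eq ?_ continuous_const
  refine continuous_of_dominated (bound := fun _ => ‖φ‖)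
    (fun M => (φ.continuous.comp (continuous_act_right M)).aestronglyMeasurable)
    (fun M => ae_of_all _ fun x => φ.norm_coe_le_norm _) (integrable_const _)
    (ae_of_all _ fun x => φ.continuous.comp (continuous_act_left x))

theorem generatedGroup_le_measureStabilizer (ν : Measure SL(2, ℝ)) (μ : Measure UnitCircle)
    [IsProbabilityMeasure μ] (h : ∀ᵐ M ∂ν, μ.map (act M) = μ) :
    generatedGroup ν ≤ measureStabilizer μ :=
  (isLeast_generatedGroup ν).2 ⟨isClosed_measureStabilizer μ,
    Measure.support_subset_of_isClosed (isClosed_measureStabilizer μ) h⟩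

theorem isClosed_generatedGroup (ν : Measure SL(2, ℝ)) :
    IsClosed (generatedGroup ν : Set SL(2, ℝ)) := (isLeast_generatedGroup ν).1.1

/-! ### Independent products and the transfer operator. -/

/-- The law of an independent sequence of matrices with common law `ν`. -/
noncomputable abbrev seqLaw (ν : Measure SL(2, ℝ)) : Measure (ℕ → SL(2, ℝ)) :=
  Measure.infinitePi fun _ : ℕ => ν

/-- The sequence `T` without its first `m` terms. -/
def shift (m : ℕ) (T : ℕ → SL(2, ℝ)) : ℕ → SL(2, ℝ) := fun k => T (k + m)

theorem shift_add (m n : ℕ) (T : ℕ → SL(2, ℝ)) : shift m (shift n T) = shift (m + n) T := by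
  funext k; simp [shift, add_assoc]

theorem matrixProduct_add (T : ℕ → SL(2, ℝ)) (m n : ℕ) :
    matrixProduct T (m + n) = matrixProduct (shift m T) n * matrixProduct T m := by
  induction n with
  | zero => simp [matrixProduct]
  | succ n ih => rw [← add_assoc, matrixProduct, ih, matrixProduct, shift, mul_assoc, add_comm m n]

theorem matrixProduct_congr {T T' : ℕ → SL(2, ℝ)} {n : ℕ} (h : ∀ k < n, T k = T' k) :
    matrixProduct T n = matrixProduct T' n := by
  induction n with
  | zero => rfl
  | succ n ih =>
    rw [matrixProduct, matrixProduct, h n (Nat.lt_succ_self n),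
      ih fun k hk => h k (hk.trans (Nat.lt_succ_self n))]

theorem matrixProduct_one (T : ℕ → SL(2, ℝ)) : matrixProduct T 1 = T 0 := by
  simp [matrixProduct]

theorem measurable_matrixProduct (n : ℕ) :
    Measurable fun T : ℕ → SL(2, ℝ) => matrixProduct T n := by
  induction n with
  | zero => exact measurable_const
  | succ n ih => exact (measurable_pi_apply n).mul ih

theorem measurePreserving_shift (ν : Measure SL(2, ℝ)) [IsProbabilityMeasure ν] (m : ℕ) :
    MeasurePreserving (shift m) (seqLaw ν) (seqLaw ν) where
  measurable := measurable_pi_lambda _ fun k => measurable_pi_apply (k + m)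
  map_eq := Measure.map_infinitePi_infinitePi_of_inj (P := fun _ : ℕ => ν) (add_left_injective m)

/-- Products of disjoint blocks are independent. -/
theorem indepFun_matrixProduct_shift (ν : Measure SL(2, ℝ)) [IsProbabilityMeasure ν]
    {m n m' n' : ℕ} (h : m + n ≤ m') :
    IndepFun (fun T => matrixProduct (shift m T) n) (fun T => matrixProduct (shift m' T) n')
      (seqLaw ν) := by
  -- The block product as a function of its own coordinates only; the default value `1` is never
  -- reached by the first `n` factors.
  let ψ (m n : ℕ) (y : Finset.Ico m (m + n) → SL(2, ℝ)) : SL(2, ℝ) :=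
    matrixProduct (fun k => if hk : k + m ∈ Finset.Ico m (m + n) then y ⟨k + m, hk⟩ else 1) n
  have hψm : ∀ m n, Measurable (ψ m n) := fun m n => by
    refine (measurable_matrixProduct n).comp (measurable_pi_lambda _ fun k => ?_)
    by_cases hk : k + m ∈ Finset.Ico m (m + n)
    · simp only [hk, dite_true]; exact measurable_pi_apply _
    · simp only [hk, dite_false]; exact measurable_const
  have hψ : ∀ m n, (fun T => matrixProduct (shift m T) n) =
      ψ m n ∘ fun T (i : Finset.Ico m (m + n)) => T i := fun m n => by
    funext T
    refine matrixProduct_congr fun k hk => ?_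
    have hk' : k + m ∈ Finset.Ico m (m + n) := by rw [Finset.mem_Ico]; omega
    simp only [hk', dite_true, shift]
  have hind : iIndepFun (fun (i : ℕ) (T : ℕ → SL(2, ℝ)) => T i) (seqLaw ν) :=
    iIndepFun_infinitePi (X := fun _ M => M) fun _ => measurable_id
  have hdisj : Disjoint (Finset.Ico m (m + n)) (Finset.Ico m' (m' + n')) := by
    rw [Finset.disjoint_left]
    intro i hi hi'
    rw [Finset.mem_Ico] at hi hi'
    omega
  rw [hψ m n, hψ m' n']
  exact (hind.indepFun_finset _ _ hdisj fun i => measurable_pi_apply i).comp (hψm m n) (hψm m' n')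

/-- The expectation of a function of `T_{n+1} ⋯ T_1` as an iterated integral. -/
theorem lintegral_matrixProduct_succ (ν : Measure SL(2, ℝ)) [IsProbabilityMeasure ν] (n : ℕ)
    {f : SL(2, ℝ) → ℝ≥0∞} (hf : Measurable f) :
    ∫⁻ T, f (matrixProduct T (n + 1)) ∂(seqLaw ν) =
      ∫⁻ T, ∫⁻ M, f (M * matrixProduct T n) ∂ν ∂(seqLaw ν) := by
  have hind := indepFun_matrixProduct_shift ν (m := 0) (n := n) (m' := n) (n' := 1) (by omega)
  have hm0 := measurable_matrixProduct n
  have e1 : (fun T : ℕ → SL(2, ℝ) => matrixProduct (shift 0 T) n) = fun T => matrixProduct T n :=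
    rfl
  have e2 : (fun T : ℕ → SL(2, ℝ) => matrixProduct (shift n T) 1) = fun T => T n := by
    funext T; simp [matrixProduct, shift]
  rw [e1, e2] at hind
  have hmap := (indepFun_iff_map_prod_eq_prod_map_map hm0.aemeasurable
    (measurable_pi_apply n).aemeasurable).1 hind
  rw [Measure.infinitePi_map_eval] at hmap
  have hfm : Measurable fun p : SL(2, ℝ) × SL(2, ℝ) => f (p.2 * p.1) :=
    hf.comp (measurable_snd.mul measurable_fst)
  have hpair : Measurable fun T : ℕ → SL(2, ℝ) => (matrixProduct T n, T n) :=
    hm0.prodMk (measurable_pi_apply n)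
  have h1 : ∫⁻ T, f (matrixProduct T (n + 1)) ∂(seqLaw ν) =
      ∫⁻ p, f (p.2 * p.1) ∂((seqLaw ν).map fun T => (matrixProduct T n, T n)) := by
    rw [lintegral_map hfm hpair]; rfl
  rw [h1, hmap, lintegral_prod _ hfm.aemeasurable, lintegral_map hfm.lintegral_prod_right' hm0]

/-- The weight is a cocycle, so integrating out the newest, leftmost factor replaces `f` by
`transfer ν f`. -/
theorem lintegral_twist_matrixProduct (ν : Measure SL(2, ℝ)) [IsProbabilityMeasure ν] (n : ℕ)
    {f : UnitCircle → ℝ≥0∞} (hf : Measurable f) (x : UnitCircle) :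
    ∫⁻ T, twist (matrixProduct T n) f x ∂(seqLaw ν) = (transfer ν)^[n] f x := by
  induction n generalizing f with
  | zero => simp [matrixProduct, twist, act_one, weight_one]
  | succ n ih =>
    have hm : Measurable fun M => twist M f x :=
      Measurable.comp (g := fun p : SL(2, ℝ) × UnitCircle => twist p.1 f p.2)
        (f := fun M : SL(2, ℝ) => (M, x)) (measurable_twist_uncurry hf) measurable_prodMk_right
    rw [lintegral_matrixProduct_succ ν n hm, Function.iterate_succ_apply,
      ← ih (measurable_transfer ν hf)]
    refine lintegral_congr fun T => ?_
    rw [twist, transfer, ← lintegral_mul_const' _ _ (weight_ne_top _ _)]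
    refine lintegral_congr fun M => ?_
    rw [twist, twist, act_mul, weight_mul, mul_assoc]

/-- The mean of `‖T_n ⋯ T_1‖⁻¹` decays exponentially if the numerical range of the transfer
operator stays away from `1`. -/
theorem exists_lintegral_inv_opNorm_le (ν : Measure SL(2, ℝ)) [IsProbabilityMeasure ν] {q : ℝ≥0∞}
    (hq : q < 1) (hgap : ∀ f : UnitCircle → ℝ≥0∞, Measurable f →
      ∫⁻ x, f x * transfer ν f x ∂arc ≤ q * ∫⁻ x, f x ^ 2 ∂arc) :
    ∃ s : ℝ≥0∞, 1 < s ∧ s ≠ ∞ ∧ ∃ C : ℝ≥0∞, C ≠ ∞ ∧ ∀ n,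
      s ^ n * ∫⁻ T, ENNReal.ofReal (opNorm (matrixProduct T n))⁻¹ ∂(seqLaw ν) ≤ C := by
  obtain ⟨s, hs1, hs, C, hC, h⟩ := exists_transfer_iterate_decay ν hq hgap
  have harc0 : arc Set.univ ≠ 0 := by
    rw [Ne, Measure.measure_univ_eq_zero]; exact arc_ne_zero
  refine ⟨s, hs1, hs, C / arc Set.univ, ENNReal.div_ne_top hC harc0, fun n => ?_⟩
  rw [ENNReal.le_div_iff_mul_le (Or.inl harc0) (Or.inl (measure_ne_top _ _)), mul_assoc,
    ← lintegral_const]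
  refine le_trans (mul_le_mul_right (lintegral_mono fun x => ?_) _) (h n)
  rw [← lintegral_twist_matrixProduct ν n measurable_one]
  refine lintegral_mono fun T => ?_
  rw [twist, Pi.one_apply, one_mul]
  exact ENNReal.ofReal_le_ofReal
    (inv_anti₀ (norm_toCLM_pos _ _) (norm_toCLM_le _ _))

/-! ### The mean growth rate and its positivity. -/

/-- `log ‖T_n ⋯ T_1‖`. -/
noncomputable def logNorm (n : ℕ) (T : ℕ → SL(2, ℝ)) : ℝ := Real.log (opNorm (matrixProduct T n))

theorem logNorm_nonneg (n : ℕ) (T : ℕ → SL(2, ℝ)) : 0 ≤ logNorm n T := log_opNorm_nonneg _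

theorem logNorm_add_le (m n : ℕ) (T : ℕ → SL(2, ℝ)) :
    logNorm (m + n) T ≤ logNorm m T + logNorm n (shift m T) := by
  rw [logNorm, matrixProduct_add, add_comm]
  exact log_opNorm_mul_le _ _

theorem measurable_log_opNorm : Measurable fun M : SL(2, ℝ) => Real.log (opNorm M) :=
  Real.measurable_log.comp continuous_opNorm.measurable

theorem measurable_logNorm (n : ℕ) : Measurable (logNorm n) :=
  measurable_log_opNorm.comp (measurable_matrixProduct n)

theorem logNorm_one (T : ℕ → SL(2, ℝ)) : logNorm 1 T = Real.log (opNorm (T 0)) := by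
  rw [logNorm, matrixProduct_one]

theorem integrable_logNorm {ν : Measure SL(2, ℝ)} [IsProbabilityMeasure ν]
    (hlog : LogIntegrable ν) (n : ℕ) : Integrable (logNorm n) (seqLaw ν) := by
  have h1 : Integrable (logNorm 1) (seqLaw ν) := by
    have h := (measurePreserving_eval_infinitePi (fun _ : ℕ => ν) 0).integrable_comp_of_integrable
      hlog
    exact h.congr (ae_of_all _ fun T => (logNorm_one T).symm)
  induction n with
  | zero =>
    refine h1.mono' (measurable_logNorm 0).aestronglyMeasurable (ae_of_all _ fun T => ?_)
    rw [Real.norm_of_nonneg (logNorm_nonneg _ _)]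
    have : logNorm 0 T = 0 := by simp [logNorm, matrixProduct, opNorm_eq, toCLM_one]
    rw [this]
    exact logNorm_nonneg _ _
  | succ n ih =>
    have h2 := (measurePreserving_shift ν n).integrable_comp_of_integrable h1
    refine (ih.add h2).mono' (measurable_logNorm _).aestronglyMeasurable (ae_of_all _ fun T => ?_)
    rw [Real.norm_of_nonneg (logNorm_nonneg _ _)]
    exact logNorm_add_le n 1 T

theorem integral_logNorm_shift {ν : Measure SL(2, ℝ)} [IsProbabilityMeasure ν] (m n : ℕ) :
    ∫ T, logNorm n (shift m T) ∂(seqLaw ν) = ∫ T, logNorm n T ∂(seqLaw ν) := by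
  have h := measurePreserving_shift ν m
  conv_rhs => rw [← h.map_eq]
  rw [integral_map h.measurable.aemeasurable (measurable_logNorm n).aestronglyMeasurable]

theorem subadditive_integral_logNorm {ν : Measure SL(2, ℝ)} [IsProbabilityMeasure ν]
    (hlog : LogIntegrable ν) : Subadditive fun n => ∫ T, logNorm n T ∂(seqLaw ν) := by
  intro m n
  have h2 : Integrable (fun T => logNorm n (shift m T)) (seqLaw ν) :=
    (measurePreserving_shift ν m).integrable_comp_of_integrable (integrable_logNorm hlog n)
  beta_reduce
  rw [← integral_logNorm_shift m n, ← integral_add (integrable_logNorm hlog m) h2]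
  exact integral_mono (integrable_logNorm hlog _) ((integrable_logNorm hlog m).add h2)
    fun T => logNorm_add_le m n T

theorem bddBelow_integral_logNorm_div (ν : Measure SL(2, ℝ)) :
    BddBelow (Set.range fun n : ℕ => (∫ T, logNorm n T ∂(seqLaw ν)) / n) :=
  ⟨0, by rintro _ ⟨n, rfl⟩; exact div_nonneg (integral_nonneg (logNorm_nonneg n)) n.cast_nonneg⟩

/-- Positivity of the mean growth rate. -/
theorem subadditive_lim_pos {ν : Measure SL(2, ℝ)} [IsProbabilityMeasure ν]
    (hlog : LogIntegrable ν) {q : ℝ≥0∞}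
    (hq : q < 1) (hgap : ∀ f : UnitCircle → ℝ≥0∞, Measurable f →
      ∫⁻ x, f x * transfer ν f x ∂arc ≤ q * ∫⁻ x, f x ^ 2 ∂arc) :
    0 < (subadditive_integral_logNorm hlog).lim := by
  obtain ⟨s, hs1, hs, C, hC, h⟩ := exists_lintegral_inv_opNorm_le ν hq hgap
  lift s to ℝ≥0 using hs
  lift C to ℝ≥0 using hC
  have hs1' : (1 : ℝ) < s := by exact_mod_cast hs1
  have hjensen : ∀ n, Real.exp (-∫ T, logNorm n T ∂(seqLaw ν)) * s ^ n ≤ C := by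
    intro n
    set m := ∫ T, logNorm n T ∂(seqLaw ν) with hm
    have hint := integrable_logNorm hlog n
    have hi : Integrable (fun T => (opNorm (matrixProduct T n))⁻¹) (seqLaw ν) := by
      refine (integrable_const (1 : ℝ)).mono' ?_ (ae_of_all _ fun T => ?_)
      · exact ((continuous_opNorm.measurable.comp
          (measurable_matrixProduct n)).inv).aestronglyMeasurable
      · rw [Real.norm_of_nonneg (inv_nonneg.2 (opNorm_pos _).le)]
        exact inv_le_one_of_one_le₀ (one_le_opNorm _)
    -- Jensen's inequality by hand: the tangent line of `exp (-t)` at the mean `m`.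
    have hpt : ∀ T, Real.exp (-m) * (1 + m - logNorm n T) ≤ (opNorm (matrixProduct T n))⁻¹ := by
      intro T
      have e : (opNorm (matrixProduct T n))⁻¹ = Real.exp (-m) * Real.exp (m - logNorm n T) := by
        rw [← Real.exp_add, ← Real.exp_log (opNorm_pos (matrixProduct T n)), ← Real.exp_neg,
          logNorm]
        ring_nf
      rw [e]
      refine mul_le_mul_of_nonneg_left ?_ (Real.exp_pos _).le
      linarith [Real.add_one_le_exp (m - logNorm n T)]
    have h1 : Real.exp (-m) ≤ ∫ T, (opNorm (matrixProduct T n))⁻¹ ∂(seqLaw ν) := by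
      have hi2 : Integrable (fun T => 1 + m - logNorm n T) (seqLaw ν) :=
        (integrable_const _).sub hint
      have h2 := integral_mono (hi2.const_mul (Real.exp (-m))) hi hpt
      rw [integral_const_mul, integral_sub (integrable_const _) hint, ← hm] at h2
      simpa using h2
    have h3 := h n
    rw [← ofReal_integral_eq_lintegral_ofReal hi
      (ae_of_all _ fun T => inv_nonneg.2 (opNorm_pos _).le)] at h3
    have h4 : (s : ℝ) ^ n * ∫ T, (opNorm (matrixProduct T n))⁻¹ ∂(seqLaw ν) ≤ C := by
      have h5 := ENNReal.toReal_mono ENNReal.coe_ne_top h3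
      rwa [ENNReal.toReal_mul, ENNReal.toReal_pow, ENNReal.coe_toReal, ENNReal.coe_toReal,
        ENNReal.toReal_ofReal (integral_nonneg fun T => inv_nonneg.2 (opNorm_pos _).le)] at h5
    rw [mul_comm]
    exact (mul_le_mul_of_nonneg_left h1 (by positivity)).trans h4
  have hlow : ∀ n : ℕ, 0 < n →
      Real.log s - Real.log C / n ≤ (∫ T, logNorm n T ∂(seqLaw ν)) / n := by
    intro n hn
    have hn' : (0 : ℝ) < n := by exact_mod_cast hn
    have h1 := Real.log_le_log (by positivity) (hjensen n)
    rw [Real.log_mul (by positivity) (by positivity), Real.log_exp, Real.log_pow] at h1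
    rw [le_div_iff₀ hn', sub_mul, div_mul_cancel₀ _ hn'.ne']
    linarith
  have hlim := (subadditive_integral_logNorm hlog).tendsto_lim (bddBelow_integral_logNorm_div ν)
  have hlim2 : Tendsto (fun n : ℕ => Real.log s - Real.log C / n) atTop (𝓝 (Real.log s)) := by
    simpa using (tendsto_const_nhds (x := Real.log s)).sub
      (tendsto_const_div_atTop_nhds_zero_nat (Real.log C))
  have hle := le_of_tendsto_of_tendsto hlim2 hlim
    ((eventually_gt_atTop 0).mono fun n hn => hlow n hn)
  exact (Real.log_pos hs1').trans_le hle

/-! ### The Furstenberg–Kesten theorem: upper bound. -/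

theorem logNorm_shift_add_le (i m n : ℕ) (T : ℕ → SL(2, ℝ)) :
    logNorm (m + n) (shift i T) ≤ logNorm m (shift i T) + logNorm n (shift (i + m) T) := by
  have h := logNorm_add_le m n (shift i T)
  rwa [shift_add, add_comm m i] at h

theorem logNorm_zero (T : ℕ → SL(2, ℝ)) : logNorm 0 T = 0 := by
  simp [logNorm, matrixProduct, opNorm_eq, toCLM_one]

theorem logNorm_mul_le_sum (m k : ℕ) (T : ℕ → SL(2, ℝ)) :
    logNorm (k * m) T ≤ ∑ i ∈ Finset.range k, logNorm m (shift (i * m) T) := by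
  induction k with
  | zero => simp [logNorm_zero]
  | succ k ih =>
    rw [Finset.sum_range_succ, Nat.succ_mul]
    exact (logNorm_add_le _ _ _).trans (add_le_add_left ih _)

theorem logNorm_shift_le_sum (i n : ℕ) (T : ℕ → SL(2, ℝ)) :
    logNorm n (shift i T) ≤ ∑ j ∈ Finset.Ico i (i + n), logNorm 1 (shift j T) := by
  induction n with
  | zero => simp [logNorm_zero]
  | succ n ih =>
    rw [← add_assoc, Finset.sum_Ico_succ_top (by omega)]
    exact (logNorm_shift_add_le i n 1 T).trans (add_le_add_left ih _)

/-- The strong law of large numbers for disjoint blocks of length `m`. -/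
theorem tendsto_sum_logNorm_div {ν : Measure SL(2, ℝ)} [IsProbabilityMeasure ν]
    (hlog : LogIntegrable ν) (m : ℕ) : ∀ᵐ T ∂(seqLaw ν),
      Tendsto (fun k : ℕ => (∑ i ∈ Finset.range k, logNorm m (shift (i * m) T)) / k) atTop
        (𝓝 (∫ T, logNorm m T ∂(seqLaw ν))) := by
  have hmeas : ∀ i, Measurable fun T => logNorm m (shift (i * m) T) := fun i =>
    (measurable_logNorm m).comp (measurePreserving_shift ν _).measurable
  have hlt : ∀ i j, i < j → IndepFun (fun T => logNorm m (shift (i * m) T))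
      (fun T => logNorm m (shift (j * m) T)) (seqLaw ν) := fun i j hij => by
    have h : i * m + m ≤ j * m := by
      rw [← Nat.succ_mul]; exact Nat.mul_le_mul_right m hij
    exact (indepFun_matrixProduct_shift ν (n := m) (n' := m) h).comp measurable_log_opNorm
      measurable_log_opNorm
  have h := strong_law_ae_real (μ := seqLaw ν) (fun i T => logNorm m (shift (i * m) T))
    (by simpa [shift] using! integrable_logNorm hlog m)
    (fun i j hij => (lt_or_gt_of_ne hij).elim (hlt i j) fun hji => (hlt j i hji).symm)
    (fun i => ⟨(hmeas i).aemeasurable, (hmeas 0).aemeasurable, by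
      have e : ∀ j, (seqLaw ν).map (fun T => logNorm m (shift (j * m) T)) =
          (seqLaw ν).map (logNorm m) := fun j => by
        have hs := measurePreserving_shift ν (j * m)
        conv_rhs => rw [← hs.map_eq]
        rw [Measure.map_map (measurable_logNorm m) hs.measurable]
        rfl
      rw [e, e]⟩)
  rwa [integral_logNorm_shift] at h

theorem tendsto_nat_div_div {m : ℕ} (hm : m ≠ 0) :
    Tendsto (fun n : ℕ => ((n / m : ℕ) : ℝ) / n) atTop (𝓝 (1 / m)) := by
  have h := (tendsto_nat_floor_mul_div_atTop (R := ℝ) (a := 1 / m) (by positivity)).comp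
    tendsto_natCast_atTop_atTop
  refine h.congr fun n => ?_
  rw [Function.comp_apply, one_div_mul_eq_div, Nat.floor_div_eq_div]

/-- The upper bound for the growth rate. -/
theorem limsup_logNorm_div_le {ν : Measure SL(2, ℝ)} [IsProbabilityMeasure ν]
    (hlog : LogIntegrable ν) : ∀ᵐ T ∂(seqLaw ν),
      limsup (fun n : ℕ => ENNReal.ofReal (logNorm n T / n)) atTop ≤
        ENNReal.ofReal (subadditive_integral_logNorm hlog).lim := by
  have hlaw : ∀ᵐ T ∂(seqLaw ν), ∀ m : ℕ,
      Tendsto (fun k : ℕ => (∑ i ∈ Finset.range k, logNorm m (shift (i * m) T)) / k) atTop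
        (𝓝 (∫ T, logNorm m T ∂(seqLaw ν))) := ae_all_iff.2 (tendsto_sum_logNorm_div hlog)
  filter_upwards [hlaw] with T hT
  have hm : ∀ m : ℕ, m ≠ 0 → limsup (fun n : ℕ => ENNReal.ofReal (logNorm n T / n)) atTop ≤
      ENNReal.ofReal ((∫ T, logNorm m T ∂(seqLaw ν)) / m) := by
    intro m hm0
    have hm0' : (m : ℝ) ≠ 0 := by exact_mod_cast hm0
    -- The `n % m` factors left after the full blocks cost at most `S n - S (n / m * m)`. This is
    -- `o(n)`, since `S n / n` converges by the strong law with `m = 1`.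
    set S : ℕ → ℝ := fun n => ∑ i ∈ Finset.range n, logNorm 1 (shift i T) with hS
    have hSlim : Tendsto (fun n : ℕ => S n / n) atTop (𝓝 (∫ T, logNorm 1 T ∂(seqLaw ν))) := by
      simpa only [mul_one] using hT 1
    have hdiv : Tendsto (fun n : ℕ => n / m) atTop atTop := Nat.tendsto_div_const_atTop hm0
    have hmul : Tendsto (fun n : ℕ => n / m * m) atTop atTop :=
      hdiv.atTop_mul_const' (Nat.pos_of_ne_zero hm0)
    have hratio := tendsto_nat_div_div hm0
    have t1 := ((hT m).comp hdiv).mul hratio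
    have t2 := (hSlim.comp hmul).mul (hratio.mul_const (m : ℝ))
    have t3 := (t1.add hSlim).sub t2
    rw [one_div_mul_cancel hm0', mul_one, add_sub_cancel_right, mul_one_div] at t3
    have hle : ∀ᶠ n : ℕ in atTop, logNorm n T / n ≤
        ((∑ i ∈ Finset.range (n / m), logNorm m (shift (i * m) T)) / (n / m : ℕ)) *
          (((n / m : ℕ) : ℝ) / n) + S n / n -
        (S (n / m * m) / (n / m * m : ℕ)) * (((n / m : ℕ) : ℝ) / n * m) := by
      filter_upwards [eventually_ge_atTop m] with n hn
      have hn0 : (0 : ℝ) < n := by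
        exact_mod_cast (Nat.pos_of_ne_zero hm0).trans_le hn
      have hk0 : ((n / m : ℕ) : ℝ) ≠ 0 := by
        exact_mod_cast (Nat.div_pos hn (Nat.pos_of_ne_zero hm0)).ne'
      have hnat : n / m * m + n % m = n := Nat.div_add_mod' n m
      have h1 : logNorm n T ≤ ∑ i ∈ Finset.range (n / m), logNorm m (shift (i * m) T) +
          (S n - S (n / m * m)) := by
        have h2 := logNorm_add_le (n / m * m) (n % m) T
        have h3 := logNorm_shift_le_sum (n / m * m) (n % m) T
        rw [hnat] at h2 h3
        rw [Finset.sum_Ico_eq_sub _ (Nat.div_mul_le_self n m)] at h3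
        exact h2.trans (add_le_add (logNorm_mul_le_sum m (n / m) T) h3)
      refine (div_le_div_of_nonneg_right h1 hn0.le).trans_eq ?_
      push_cast
      field_simp
      ring
    calc limsup (fun n : ℕ => ENNReal.ofReal (logNorm n T / n)) atTop
        ≤ limsup (fun n : ℕ => ENNReal.ofReal
            (((∑ i ∈ Finset.range (n / m), logNorm m (shift (i * m) T)) / (n / m : ℕ)) *
              (((n / m : ℕ) : ℝ) / n) + S n / n -
              (S (n / m * m) / (n / m * m : ℕ)) * (((n / m : ℕ) : ℝ) / n * m))) atTop :=
          limsup_le_limsup (hle.mono fun n hn => ENNReal.ofReal_le_ofReal hn)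
      _ = _ := ((ENNReal.continuous_ofReal.tendsto _).comp t3).limsup_eq
  have hlim := (subadditive_integral_logNorm hlog).tendsto_lim (bddBelow_integral_logNorm_div ν)
  exact ge_of_tendsto ((ENNReal.continuous_ofReal.tendsto _).comp hlim)
    ((eventually_ne_atTop 0).mono fun m h => hm m h)

/-! ### The Furstenberg–Kesten theorem: lower bound. -/

/-- The lower growth rate of the products `T_n ⋯ T_1`. -/
noncomputable def lowerRate (T : ℕ → SL(2, ℝ)) : ℝ≥0∞ :=
  liminf (fun n : ℕ => ENNReal.ofReal (logNorm n T / n)) atTop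

theorem measurable_lowerRate : Measurable lowerRate :=
  Measurable.liminf fun n => ENNReal.measurable_ofReal.comp ((measurable_logNorm n).div_const _)

theorem frequently_logNorm_lt {T : ℕ → SL(2, ℝ)} {c : ℝ} (h : lowerRate T < ENNReal.ofReal c) :
    ∃ᶠ n : ℕ in atTop, logNorm n T < n * c := by
  have h1 := (frequently_lt_of_liminf_lt (by isBoundedDefault) h).and_eventually
    (eventually_gt_atTop 0)
  refine h1.mono fun n hn => ?_
  have hn0 : (0 : ℝ) < n := by exact_mod_cast hn.2
  have h2 := (ENNReal.ofReal_lt_ofReal_iff'.1 hn.1).1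
  rwa [div_lt_iff₀' hn0] at h2

theorem lowerRate_le_of_frequently {T : ℕ → SL(2, ℝ)} {c : ℝ}
    (h : ∃ᶠ n : ℕ in atTop, logNorm n T ≤ n * c) : lowerRate T ≤ ENNReal.ofReal c := by
  refine liminf_le_of_frequently_le' ((h.and_eventually (eventually_gt_atTop 0)).mono fun n hn => ?_)
  have hn0 : (0 : ℝ) < n := by exact_mod_cast hn.2
  exact ENNReal.ofReal_le_ofReal ((div_le_iff₀' hn0).2 hn.1)

theorem logNorm_shift_one_le (n : ℕ) (T : ℕ → SL(2, ℝ)) :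
    logNorm n (shift 1 T) ≤ logNorm (n + 1) T + Real.log (opNorm (T 0)⁻¹) := by
  have h : matrixProduct (shift 1 T) n = matrixProduct T (n + 1) * (T 0)⁻¹ := by
    rw [add_comm, matrixProduct_add, matrixProduct_one, mul_inv_cancel_right]
  rw [logNorm, h]
  exact log_opNorm_mul_le _ _

/-- Dropping the first factor adds at most the constant `log ‖T_1⁻¹‖` to the log norm, which is
absorbed by the gap between the rates `a < d`. -/
theorem lowerRate_shift_one_le (T : ℕ → SL(2, ℝ)) : lowerRate (shift 1 T) ≤ lowerRate T := by
  refine le_of_forall_gt_imp_ge_of_dense fun b hb => ?_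
  obtain ⟨a, ha, hab⟩ := exists_between hb
  obtain ⟨d, had, hdb⟩ := exists_between hab
  lift a to ℝ≥0 using hab.ne_top
  lift d to ℝ≥0 using hdb.ne_top
  have had' : (a : ℝ) < d := by exact_mod_cast had
  rw [← ENNReal.ofReal_coe_nnreal (p := a)] at ha
  refine le_trans ?_ hdb.le
  rw [← ENNReal.ofReal_coe_nnreal (p := d)]
  refine lowerRate_le_of_frequently ?_
  have hlarge : ∀ᶠ n : ℕ in atTop, (a : ℝ) + Real.log (opNorm (T 0)⁻¹) ≤ n * ((d : ℝ) - a) :=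
    (tendsto_natCast_atTop_atTop.atTop_mul_const (sub_pos.2 had')).eventually_ge_atTop _
  have hf : ∃ᶠ n : ℕ in atTop, logNorm (n + 1) T < (n + 1 : ℕ) * (a : ℝ) := by
    refine frequently_atTop.2 fun m => ?_
    obtain ⟨k, hk, hlt⟩ := frequently_atTop.1 (frequently_logNorm_lt ha) (m + 1)
    refine ⟨k - 1, by omega, ?_⟩
    rwa [Nat.sub_add_cancel (by omega)]
  refine (hf.and_eventually hlarge).mono fun n hn => ?_
  have h1 := logNorm_shift_one_le n T
  have h2 := hn.1
  have h3 := hn.2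
  push_cast at h2
  linarith

theorem lowerRate_shift_le (i : ℕ) (T : ℕ → SL(2, ℝ)) : lowerRate (shift i T) ≤ lowerRate T := by
  induction i with
  | zero => exact le_rfl
  | succ i ih =>
    have h := lowerRate_shift_one_le (shift i T)
    rw [shift_add, add_comm] at h
    exact h.trans ih

/-- If every time outside `B` starts a block of length at most `N` with growth rate at most `c`,
then the product of length `L` grows at most at rate `c`, up to the contributions of `B` and of the
last `N` factors. -/
theorem logNorm_le_of_blocks {T : ℕ → SL(2, ℝ)} {B : Set (ℕ → SL(2, ℝ))} {c : ℝ} (hc : 0 ≤ c)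
    {N : ℕ} (hB : ∀ i, shift i T ∉ B → ∃ n, 0 < n ∧ n ≤ N ∧ logNorm n (shift i T) ≤ n * c)
    (L i : ℕ) : logNorm L (shift i T) ≤ L * c +
      ∑ j ∈ Finset.Ico i (i + L), B.indicator (logNorm 1) (shift j T) +
      ∑ j ∈ Finset.Ico (i + L - N) (i + L), logNorm 1 (shift j T) := by
  have hnn : ∀ a b : ℕ, 0 ≤ ∑ j ∈ Finset.Ico a b, B.indicator (logNorm 1) (shift j T) := fun a b =>
    Finset.sum_nonneg fun j _ => Set.indicator_nonneg (fun _ _ => logNorm_nonneg _ _) _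
  induction L using Nat.strong_induction_on generalizing i with
  | _ L ih =>
    rcases le_or_gt L N with hLN | hLN
    -- A good block starting here might overrun the end, so the whole remainder is charged to the
    -- last `N` factors.
    · have h1 := logNorm_shift_le_sum i L T
      have h2 : ∑ j ∈ Finset.Ico i (i + L), logNorm 1 (shift j T) ≤
          ∑ j ∈ Finset.Ico (i + L - N) (i + L), logNorm 1 (shift j T) :=
        Finset.sum_le_sum_of_subset_of_nonneg (Finset.Ico_subset_Ico_left (by omega))
          fun _ _ _ => logNorm_nonneg _ _
      have h3 := hnn i (i + L)
      have h4 : 0 ≤ L * c := by positivity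
      linarith
    · by_cases hi : shift i T ∈ B
      · obtain ⟨l, rfl⟩ : ∃ l, L = 1 + l := ⟨L - 1, by omega⟩
        have h1 := logNorm_shift_add_le i 1 l T
        have h2 := ih l (by omega) (i + 1)
        -- The right end stays fixed in the induction, so the sum over the last `N` factors is paid
        -- only once.
        rw [show i + 1 + l = i + (1 + l) by omega] at h2
        rw [Finset.sum_eq_sum_Ico_succ_bot (by omega), Set.indicator_of_mem hi]
        push_cast
        linarith
      · obtain ⟨n, hn0, hnN, hn⟩ := hB i hi
        obtain ⟨l, rfl⟩ : ∃ l, L = n + l := ⟨L - n, by omega⟩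
        have h1 := logNorm_shift_add_le i n l T
        have h2 := ih l (by omega) (i + n)
        rw [show i + n + l = i + (n + l) by omega] at h2
        have h3 := Finset.sum_Ico_consecutive (fun j => B.indicator (logNorm 1) (shift j T))
          (show i ≤ i + n by omega) (show i + n ≤ i + (n + l) by omega)
        have h4 := hnn i (i + n)
        push_cast
        linarith

theorem lowerRate_le_lim {ν : Measure SL(2, ℝ)} [IsProbabilityMeasure ν]
    (hlog : LogIntegrable ν) : ∀ᵐ T ∂(seqLaw ν),
      lowerRate T ≤ ENNReal.ofReal (subadditive_integral_logNorm hlog).lim :=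
  (limsup_logNorm_div_le hlog).mono fun _ hT => (liminf_le_limsup).trans hT

theorem lim_nonneg {ν : Measure SL(2, ℝ)} [IsProbabilityMeasure ν]
    (hlog : LogIntegrable ν) : 0 ≤ (subadditive_integral_logNorm hlog).lim :=
  ge_of_tendsto'
    ((subadditive_integral_logNorm hlog).tendsto_lim (bddBelow_integral_logNorm_div ν))
    fun n => div_nonneg (integral_nonneg (logNorm_nonneg n)) n.cast_nonneg

theorem integrable_lowerRate {ν : Measure SL(2, ℝ)} [IsProbabilityMeasure ν]
    (hlog : LogIntegrable ν) : Integrable (fun T => (lowerRate T).toReal) (seqLaw ν) := by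
  refine (integrable_const (subadditive_integral_logNorm hlog).lim).mono'
    measurable_lowerRate.ennreal_toReal.aestronglyMeasurable ?_
  filter_upwards [lowerRate_le_lim hlog] with T hT
  rw [Real.norm_of_nonneg ENNReal.toReal_nonneg]
  exact ENNReal.toReal_le_of_le_ofReal (lim_nonneg hlog) hT

/-- The sequences for which no initial block of length at most `N` has growth rate at most
`lowerRate T + ε`. -/
def slowSet (ε : ℝ) (N : ℕ) : Set (ℕ → SL(2, ℝ)) :=
  {T | ∀ n, 0 < n → n ≤ N → n * ((lowerRate T).toReal + ε) < logNorm n T}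

theorem measurableSet_slowSet (ε : ℝ) (N : ℕ) : MeasurableSet (slowSet ε N) := by
  have h : slowSet ε N = ⋂ n : ℕ, ⋂ _ : 0 < n, ⋂ _ : n ≤ N,
      {T | n * ((lowerRate T).toReal + ε) < logNorm n T} := by
    ext T; simp [slowSet]
  rw [h]
  refine MeasurableSet.iInter fun n => MeasurableSet.iInter fun _ => MeasurableSet.iInter fun _ => ?_
  exact measurableSet_lt ((measurable_lowerRate.ennreal_toReal.add_const ε).const_mul _)
    (measurable_logNorm n)

theorem eventually_notMem_slowSet {T : ℕ → SL(2, ℝ)} (hT : lowerRate T ≠ ∞) {ε : ℝ} (hε : 0 < ε) :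
    ∀ᶠ N in atTop, T ∉ slowSet ε N := by
  have h : lowerRate T < ENNReal.ofReal ((lowerRate T).toReal + ε) := by
    conv_lhs => rw [← ENNReal.ofReal_toReal hT]
    exact (ENNReal.ofReal_lt_ofReal_iff (by positivity)).2 (by linarith)
  obtain ⟨n, hn0, hn⟩ := frequently_atTop.1 (frequently_logNorm_lt h) 1
  filter_upwards [eventually_ge_atTop n] with N hN hmem
  exact absurd (hmem n hn0 hN) (not_lt.2 hn.le)

/-- Integrate the block estimate for length `L`, using shift invariance, and divide by `L`: the last
`N` factors disappear as `L → ∞`. -/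
theorem lim_le_integral_lowerRate_add {ν : Measure SL(2, ℝ)} [IsProbabilityMeasure ν]
    (hlog : LogIntegrable ν) {ε : ℝ} (hε : 0 < ε) (N : ℕ) :
    (subadditive_integral_logNorm hlog).lim ≤ ∫ T, (lowerRate T).toReal ∂(seqLaw ν) + ε +
      ∫ T, (slowSet ε N).indicator (logNorm 1) T ∂(seqLaw ν) := by
  set a₁ := ∫ T, logNorm 1 T ∂(seqLaw ν)
  set b := ∫ T, (slowSet ε N).indicator (logNorm 1) T ∂(seqLaw ν)
  set F := ∫ T, (lowerRate T).toReal ∂(seqLaw ν)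
  have hi1 := integrable_logNorm hlog 1
  have hib : Integrable ((slowSet ε N).indicator (logNorm 1)) (seqLaw ν) :=
    hi1.indicator (measurableSet_slowSet ε N)
  have hs1 : ∀ j, Integrable (fun T => logNorm 1 (shift j T)) (seqLaw ν) := fun j =>
    (measurePreserving_shift ν j).integrable_comp_of_integrable hi1
  have hsb : ∀ j, Integrable (fun T => (slowSet ε N).indicator (logNorm 1) (shift j T))
      (seqLaw ν) := fun j => (measurePreserving_shift ν j).integrable_comp_of_integrable hib
  have heb : ∀ j, ∫ T, (slowSet ε N).indicator (logNorm 1) (shift j T) ∂(seqLaw ν) = b := by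
    intro j
    have h := measurePreserving_shift ν j
    simp only [b]
    conv_rhs => rw [← h.map_eq]
    rw [integral_map h.measurable.aemeasurable
      ((measurable_logNorm 1).indicator (measurableSet_slowSet ε N)).aestronglyMeasurable]
  have hiF := integrable_lowerRate hlog
  have hL : ∀ L : ℕ, ∫ T, logNorm L T ∂(seqLaw ν) ≤ L * (F + ε) + L * b + N * a₁ := by
    intro L
    have hpt : ∀ᵐ T ∂(seqLaw ν), logNorm L T ≤ L * ((lowerRate T).toReal + ε) +
        ∑ j ∈ Finset.Ico 0 L, (slowSet ε N).indicator (logNorm 1) (shift j T) +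
        ∑ j ∈ Finset.Ico (L - N) L, logNorm 1 (shift j T) := by
      filter_upwards [lowerRate_le_lim hlog] with T hT
      have hfin : lowerRate T ≠ ∞ := ne_top_of_le_ne_top ENNReal.ofReal_ne_top hT
      have h := logNorm_le_of_blocks (T := T) (B := slowSet ε N)
        (c := (lowerRate T).toReal + ε) (by positivity) (N := N) (fun i hi => ?_) L 0
      · simp only [zero_add] at h
        exact h
      · simp only [slowSet, Set.mem_ofPred_eq] at hi
        push Not at hi
        obtain ⟨n, hn0, hnN, hn⟩ := hi
        refine ⟨n, hn0, hnN, hn.trans ?_⟩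
        -- The lower rate does not increase under the shift, so the single rate `lowerRate T + ε`
        -- serves at every starting time.
        have := ENNReal.toReal_mono hfin (lowerRate_shift_le i T)
        gcongr
    have hiA : Integrable (fun T => L * ((lowerRate T).toReal + ε)) (seqLaw ν) :=
      (hiF.add (integrable_const ε)).const_mul _
    have hiB : Integrable (fun T => ∑ j ∈ Finset.Ico 0 L,
        (slowSet ε N).indicator (logNorm 1) (shift j T)) (seqLaw ν) :=
      integrable_finsetSum _ fun j _ => hsb j
    have hiC : Integrable (fun T => ∑ j ∈ Finset.Ico (L - N) L, logNorm 1 (shift j T))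
        (seqLaw ν) := integrable_finsetSum _ fun j _ => hs1 j
    have h := integral_mono_ae (integrable_logNorm hlog L) ((hiA.add hiB).add hiC) hpt
    have eA : ∫ T, L * ((lowerRate T).toReal + ε) ∂(seqLaw ν) = L * (F + ε) := by
      rw [integral_const_mul, integral_add hiF (integrable_const ε)]
      simp [F]
    have eB : ∫ T, ∑ j ∈ Finset.Ico 0 L,
        (slowSet ε N).indicator (logNorm 1) (shift j T) ∂(seqLaw ν) = L * b := by
      rw [integral_finsetSum _ fun j _ => hsb j, Finset.sum_congr rfl fun j _ => heb j]
      simp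
    have eC : ∫ T, ∑ j ∈ Finset.Ico (L - N) L, logNorm 1 (shift j T) ∂(seqLaw ν) ≤ N * a₁ := by
      rw [integral_finsetSum _ fun j _ => hs1 j,
        Finset.sum_congr rfl fun j _ => integral_logNorm_shift j 1, Finset.sum_const,
        Nat.card_Ico, nsmul_eq_mul]
      refine mul_le_mul_of_nonneg_right ?_ (integral_nonneg (logNorm_nonneg 1))
      exact_mod_cast (by omega : L - (L - N) ≤ N)
    have e : ∫ T, (L * ((lowerRate T).toReal + ε) +
        ∑ j ∈ Finset.Ico 0 L, (slowSet ε N).indicator (logNorm 1) (shift j T) +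
        ∑ j ∈ Finset.Ico (L - N) L, logNorm 1 (shift j T)) ∂(seqLaw ν) =
        L * (F + ε) + L * b +
          ∫ T, ∑ j ∈ Finset.Ico (L - N) L, logNorm 1 (shift j T) ∂(seqLaw ν) := by
      rw [← eA, ← eB, ← integral_add hiA hiB]
      exact integral_add (hiA.add hiB) hiC
    have h' := h.trans_eq e
    linarith
  have hlim : Tendsto (fun L : ℕ => F + ε + b + (N * a₁) / L) atTop (𝓝 (F + ε + b)) := by
    simpa using (tendsto_const_nhds (x := F + ε + b)).add
      (tendsto_const_div_atTop_nhds_zero_nat (N * a₁))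
  refine ge_of_tendsto hlim ((eventually_gt_atTop 0).mono fun L hL0 => ?_)
  have hL0' : (0 : ℝ) < L := by exact_mod_cast hL0
  refine ((subadditive_integral_logNorm hlog).lim_le_div (bddBelow_integral_logNorm_div ν)
    hL0.ne').trans ?_
  rw [div_le_iff₀ hL0', add_mul, div_mul_cancel₀ _ hL0'.ne']
  linarith [hL L]

/-- The lower bound for the mean of the growth rate. -/
theorem lim_le_integral_lowerRate {ν : Measure SL(2, ℝ)} [IsProbabilityMeasure ν]
    (hlog : LogIntegrable ν) :
    (subadditive_integral_logNorm hlog).lim ≤ ∫ T, (lowerRate T).toReal ∂(seqLaw ν) := by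
  refine le_of_forall_pos_le_add fun ε hε => ?_
  have hb : Tendsto (fun N : ℕ => ∫ T, (slowSet ε N).indicator (logNorm 1) T ∂(seqLaw ν)) atTop
      (𝓝 (∫ _, (0 : ℝ) ∂(seqLaw ν))) := by
    refine tendsto_integral_of_dominated_convergence (logNorm 1)
      (fun N => ((measurable_logNorm 1).indicator
        (measurableSet_slowSet ε N)).aestronglyMeasurable)
      (integrable_logNorm hlog 1) (fun N => ae_of_all _ fun T => ?_) ?_
    · refine (norm_indicator_le_norm_self _ _).trans_eq ?_
      exact Real.norm_of_nonneg (logNorm_nonneg 1 T)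
    · filter_upwards [lowerRate_le_lim hlog] with T hT
      refine tendsto_const_nhds.congr' ?_
      filter_upwards [eventually_notMem_slowSet
        (ne_top_of_le_ne_top ENNReal.ofReal_ne_top hT) hε] with N hN
      exact (Set.indicator_of_notMem hN _).symm
  have h := (tendsto_const_nhds (x := ∫ T, (lowerRate T).toReal ∂(seqLaw ν) + ε)).add hb
  rw [integral_zero, add_zero] at h
  exact ge_of_tendsto' h fun N => lim_le_integral_lowerRate_add hlog hε N

/-- The Furstenberg–Kesten theorem for independent identically distributed matrices. -/
theorem isLyapunovExponent_lim {ν : Measure SL(2, ℝ)} [IsProbabilityMeasure ν]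
    (hlog : LogIntegrable ν) :
    IsLyapunovExponent ν (subadditive_integral_logNorm hlog).lim := by
  set γ := (subadditive_integral_logNorm hlog).lim with hγ
  have hγ0 : 0 ≤ γ := lim_nonneg hlog
  have hle : ∀ᵐ T ∂(seqLaw ν), (lowerRate T).toReal ≤ γ := by
    filter_upwards [lowerRate_le_lim hlog] with T hT
    exact ENNReal.toReal_le_of_le_ofReal hγ0 hT
  have hi := integrable_lowerRate hlog
  have hig : Integrable (fun T => γ - (lowerRate T).toReal) (seqLaw ν) :=
    (integrable_const γ).sub hi
  have hnn : 0 ≤ᵐ[seqLaw ν] fun T => γ - (lowerRate T).toReal :=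
    hle.mono fun T hT => sub_nonneg.2 hT
  -- The lower rate is almost surely at most `γ` and has mean at least `γ`, hence equals `γ` almost
  -- surely; this takes the place of an ergodicity argument.
  have hzero : ∫ T, (γ - (lowerRate T).toReal) ∂(seqLaw ν) = 0 := by
    refine le_antisymm ?_ (integral_nonneg_of_ae hnn)
    rw [integral_sub (integrable_const γ) hi]
    simpa using lim_le_integral_lowerRate hlog
  have hae := (integral_eq_zero_iff_of_nonneg_ae hnn hig).1 hzero
  unfold IsLyapunovExponent
  filter_upwards [hae, limsup_logNorm_div_le hlog, lowerRate_le_lim hlog] with T h1 h2 h3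
  have hfin : lowerRate T ≠ ∞ := ne_top_of_le_ne_top ENNReal.ofReal_ne_top h3
  have h4 : lowerRate T = ENNReal.ofReal γ := by
    rw [← ENNReal.ofReal_toReal hfin]
    congr 1
    exact (sub_eq_zero.1 h1).symm
  have ht := tendsto_of_le_liminf_of_limsup_le h4.ge h2
  have ht' := (ENNReal.tendsto_toReal ENNReal.ofReal_ne_top).comp ht
  rw [ENNReal.toReal_ofReal hγ0] at ht'
  refine ht'.congr fun n => ?_
  rw [Function.comp_apply, ENNReal.toReal_ofReal (div_nonneg (logNorm_nonneg n T) n.cast_nonneg),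
    logNorm, one_div, div_eq_inv_mul]

end RandomMatrixProduct

/-! ### Conclusion. -/

open RandomMatrixProduct in
theorem mainTheorem3 (ν : Measure SL(2, ℝ)) [IsProbabilityMeasure ν]
    (hlog : LogIntegrable ν)
    (hi : ¬ IsCompact (generatedGroup ν : Set SL(2, ℝ)))
    (hii : (¬ ∃ L : Set Directions, L.Finite ∧ L.Nonempty ∧ IsInvariantSet (generatedGroup ν) L) ∨
      (¬ ∃ L : Set Directions, (L.ncard = 1 ∨ L.ncard = 2) ∧
        IsInvariantSet (generatedGroup ν) L)) :
    ∃ γ : ℝ, IsLyapunovExponent ν γ ∧ 0 < γ := by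
  refine ⟨_, isLyapunovExponent_lim hlog, ?_⟩
  by_contra hpos
  -- If the exponent is not positive, the gap fails for every `q < 1`, which is what the invariant
  -- measure requires.
  obtain ⟨μ, hμ, hinv⟩ := exists_invariant_measure ν (by
    by_contra! hgap
    obtain ⟨q, hq, h⟩ := hgap
    exact hpos (subadditive_lim_pos hlog hq h))
  obtain ⟨L, hcard, hL⟩ := exists_isInvariantSet_of_invariant_measure (isClosed_generatedGroup ν) hi
    μ fun M hM => generatedGroup_le_measureStabilizer ν μ hinv hM
  -- A set with `ncard` equal to `1` or `2` is finite and nonempty, so the same `L` refutes either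
  -- alternative.
  refine hii.elim (fun h => h ⟨L, ?_, ?_, hL⟩) fun h => h ⟨L, hcard, hL⟩
  · exact Set.finite_of_ncard_pos (by omega)
  · exact Set.nonempty_of_ncard_ne_zero (by omega)
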